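/- Let $(X,d)$ be a metric space and let $\mu$ be a Borel measure on $X$ with $0<\mu(B(x,r))<\infty$ for all $x\in X$, $r\in(0,\infty)$, where $B(x,r)$ is the open ball. Notation. $\mathcal P_b(X)$ is the set of measurable $p:X\to(0,\infty)$ with $\operatorname{ess\,inf}p>0$ and $\operatorname{ess\,sup}p<\infty$. $\mathcal P_b^{\log}(X)$ is the set of $p\in\mathcal P_b(X)$ for which there is $C>0$ with $\left|\frac1{p(x)}-\frac1{p(y)}\right|\le \frac{C}{\log(e+1/d(x,y))}$ for all $x\ne y$ in $X$. We write $q\gg p$ (or $p\ll q$) if $\operatorname{ess\,inf}(q-p)>0$. For $p\in\mathcal P_b(X)$, $L^{p(\cdot)}(X,\mu)$ is the space of measurable $u:X\to\mathbb R$ with $\int_X|u|^{p(x)}\,d\mu<\infty$, with the quasi-norm $\|u\|_{L^{p(\cdot)}}=\inf\{\lambda>0:\int_X|u/\lambda|^{p(x)}\,d\mu\le1\}$. For $s,p\in\mathcal P_b(X)$, $M^{s(\cdot),p(\cdot)}(X,d,\mu)$ is the space of $u\in L^{p(\cdot)}(X,\mu)$ for which $\|u\|_{M^{s(\cdot),p(\cdot)}}:=\|u\|_{L^{p(\cdot)}}+\inf_g\|g\|_{L^{p(\cdot)}}<\infty$,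 where the infimum (with $\inf\emptyset=\infty$) is over all measurable $g:X\to[0,\infty]$ such that, for some $\mu$-null set $N$, $|u(x)-u(y)|\le d(x,y)^{s(x)}g(x)+d(x,y)^{s(y)}g(y)$ for all $x,y\in X\setminus N$. For bounded $\alpha:X\to[0,\infty)$, $C^{0,\alpha(\cdot)}(X,d)$ is the space of bounded continuous $u:X\to\mathbb R$ with finite norm $\sup_X|u|+\sup_{x\ne y}\frac{|u(x)-u(y)|}{d(x,y)^{\alpha(x)}}$. Functions equal $\mu$-almost everywhere are identified, and $\hookrightarrow$ denotes a continuous embedding. $(X,d)$ is geometrically doubling if there is $M$ such that, for all $x\in X$ and $r>0$, the ball $B(x,r)$ can be covered by at most $M$ balls of radius $r/2$. Theorem. Assume that there are $Q\in\mathcal P_b^{\log}(X)$, $\delta\in(0,\infty)$ and $b\in(0,1]$ such that $\mu(B(x,r))\ge b\,r^{Q(x)}$ for all $x\in X$ and $r\in(0,\delta]$. (i) If $(X,d)$ is geometrically doubling and $\sup_{x\in X}\mu(B(x,\delta))<\infty$, then for all $p,s\in\mathcal P_b^{\log}(X)$ with $sp\ll Q$, the function $\gamma:=\frac{Qp}{Q-sp}$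 belongs to $\mathcal P_b(X)$ and $M^{s(\cdot),p(\cdot)}(X,d,\mu)\hookrightarrow L^{\gamma(\cdot)}(X,\mu)$. (ii) If $(X,d)$ is geometrically doubling and $\sup_{x\in X}\mu(B(x,\delta))<\infty$, then for all $p,s\in\mathcal P_b^{\log}(X)$ with $sp=Q$ and every $\beta\in\mathcal P_b(X)$ with $\beta\gg p$, $M^{s(\cdot),p(\cdot)}(X,d,\mu)\hookrightarrow L^{\beta(\cdot)}(X,\mu)$. (iii) For all $p,s\in\mathcal P_b^{\log}(X)$ with $sp\gg Q$, the function $\alpha:=s-\frac Qp$ is bounded and non-negative and $M^{s(\cdot),p(\cdot)}(X,d,\mu)\hookrightarrow C^{0,\alpha(\cdot)}(X,d)$. -/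

import Mathlib

open MeasureTheory Metric
open scoped ENNReal NNReal

noncomputable section

namespace VarHajlasz

/-- `(X, d, μ)` is a metric measure space: every ball of positive radius has positive and finite
measure. -/
def IsMetricMeasure {X : Type*} [MetricSpace X] [MeasurableSpace X] (μ : Measure X) : Prop :=
  ∀ (x : X) (r : ℝ), 0 < r → 0 < μ (ball x r) ∧ μ (ball x r) < ∞

/-- `(X, d)` is geometrically doubling: there is `M` such that every ball of radius `r` is covered
by at most `M` balls of radius `r / 2`. -/
def GeometricallyDoubling (X : Type*) [MetricSpace X] : Prop :=
  ∃ M : ℕ, ∀ (x : X) (r : ℝ), 0 < r →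
    ∃ S : Finset X, S.card ≤ M ∧ ball x r ⊆ ⋃ y ∈ S, ball y (r / 2)

/-- The class of essentially bounded variable exponents: measurable positive functions `p` with
`ess inf p > 0` and `ess sup p < ∞`. -/
def BoundedExponent {X : Type*} [MeasurableSpace X] (μ : Measure X) (p : X → ℝ) : Prop :=
  Measurable p ∧ (∀ x, 0 < p x) ∧ (∃ c > 0, ∀ᵐ x ∂μ, c ≤ p x) ∧ (∃ C, ∀ᵐ x ∂μ, p x ≤ C)

/-- `q ≫ p`, that is, `ess inf (q - p) > 0`. -/
def EssGT {X : Type*} [MeasurableSpace X] (μ : Measure X) (q p : X → ℝ) : Prop :=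
  ∃ c > 0, ∀ᵐ x ∂μ, c ≤ q x - p x

/-- Local log-Hölder continuity on the whole space (only pairs of distinct points matter). -/
def LogHolder {X : Type*} [MetricSpace X] (f : X → ℝ) : Prop :=
  ∃ C > 0, ∀ x y : X, x ≠ y → |f x - f y| ≤ C / Real.log (Real.exp 1 + 1 / dist x y)

/-- The class of bounded exponents `p` such that `1 / p` is locally log-Hölder continuous. -/
def LogExponent {X : Type*} [MetricSpace X] [MeasurableSpace X] (μ : Measure X)
    (p : X → ℝ) : Prop :=
  BoundedExponent μ p ∧ LogHolder (fun x => 1 / p x)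

/-- The semi-modular `∫ f(x)^{p(x)} dμ(x)` of a function with values in `[0, ∞]`. -/
def modular {X : Type*} [MeasurableSpace X] (μ : Measure X) (p : X → ℝ) (f : X → ℝ≥0∞) : ℝ≥0∞ :=
  ∫⁻ x, f x ^ p x ∂μ

/-- The Luxemburg quasi-norm `inf {l ∈ (0, ∞) : ρ(f / l) ≤ 1}`, with `inf ∅ = ∞`. -/
def luxNorm {X : Type*} [MeasurableSpace X] (μ : Measure X) (p : X → ℝ) (f : X → ℝ≥0∞) : ℝ≥0∞ :=
  ⨅ (l : ℝ≥0) (_ : 0 < l) (_ : modular μ p (fun x => f x / (l : ℝ≥0∞)) ≤ 1), (l : ℝ≥0∞)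

/-- Membership in the variable exponent Lebesgue space. -/
def MemVarL {X : Type*} [MeasurableSpace X] (μ : Measure X) (p : X → ℝ) (u : X → ℝ) : Prop :=
  AEMeasurable u μ ∧ modular μ p (fun x => ‖u x‖ₑ) < ∞

/-- The quasi-norm of the variable exponent Lebesgue space. -/
def varLNorm {X : Type*} [MeasurableSpace X] (μ : Measure X) (p : X → ℝ) (u : X → ℝ) : ℝ≥0∞ :=
  luxNorm μ p (fun x => ‖u x‖ₑ)

/-- `g : X → [0, ∞]` is a scalar `s(·)`-gradient of `u`: the pointwise inequality holds off a
null set. -/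
def IsScalarGradient {X : Type*} [MetricSpace X] [MeasurableSpace X] (μ : Measure X)
    (s : X → ℝ) (u : X → ℝ) (g : X → ℝ≥0∞) : Prop :=
  ∃ N : Set X, μ N = 0 ∧ ∀ x ∉ N, ∀ y ∉ N,
    ENNReal.ofReal |u x - u y| ≤
      ENNReal.ofReal (dist x y ^ s x) * g x + ENNReal.ofReal (dist x y ^ s y) * g y

/-- The quasi-seminorm of the homogeneous Hajłasz–Sobolev space: the infimum of the `L^{p(·)}`
quasi-norms of the measurable scalar `s(·)`-gradients. -/
def hajlaszSeminorm {X : Type*} [MetricSpace X] [MeasurableSpace X] (μ : Measure X)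
    (s p : X → ℝ) (u : X → ℝ) : ℝ≥0∞ :=
  ⨅ (g : X → ℝ≥0∞) (_ : AEMeasurable g μ) (_ : IsScalarGradient μ s u g), luxNorm μ p g

/-- Membership in the inhomogeneous Hajłasz–Sobolev space `M^{s(·),p(·)}`. -/
def MemHajlasz {X : Type*} [MetricSpace X] [MeasurableSpace X] (μ : Measure X)
    (s p : X → ℝ) (u : X → ℝ) : Prop :=
  MemVarL μ p u ∧ hajlaszSeminorm μ s p u < ∞

/-- The quasi-norm of the inhomogeneous Hajłasz–Sobolev space `M^{s(·),p(·)}`. -/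
def hajlaszNorm {X : Type*} [MetricSpace X] [MeasurableSpace X] (μ : Measure X)
    (s p : X → ℝ) (u : X → ℝ) : ℝ≥0∞ :=
  varLNorm μ p u + hajlaszSeminorm μ s p u

/-- The supremum norm, with values in `[0, ∞]`. -/
def supNorm {X : Type*} (v : X → ℝ) : ℝ≥0∞ := ⨆ x, ‖v x‖ₑ

/-- The variable exponent Hölder seminorm
`sup {|v(x) - v(y)| / d(x,y)^{α(x)} : x ≠ y}`, with values in `[0, ∞]`. -/
def holderSeminorm {X : Type*} [MetricSpace X] (α : X → ℝ) (v : X → ℝ) : ℝ≥0∞ :=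
  ⨆ (x : X) (y : X) (_ : x ≠ y), ENNReal.ofReal (|v x - v y| / dist x y ^ α x)

/-- Membership in the inhomogeneous variable exponent Hölder space `C^{0,α(·)}`. -/
def MemHolder {X : Type*} [MetricSpace X] (α : X → ℝ) (v : X → ℝ) : Prop :=
  Continuous v ∧ supNorm v < ∞ ∧ holderSeminorm α v < ∞

/-- The norm of the inhomogeneous variable exponent Hölder space `C^{0,α(·)}`. -/
def holderNorm {X : Type*} [MetricSpace X] (α : X → ℝ) (v : X → ℝ) : ℝ≥0∞ :=
  supNorm v + holderSeminorm α v

/-- The continuous embedding `M^{s(·),p(·)} ↪ L^{q(·)}`. -/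
def EmbedsInVarL {X : Type*} [MetricSpace X] [MeasurableSpace X] (μ : Measure X)
    (s p q : X → ℝ) : Prop :=
  ∃ C : ℝ≥0, ∀ u : X → ℝ, MemHajlasz μ s p u →
    MemVarL μ q u ∧ varLNorm μ q u ≤ C * hajlaszNorm μ s p u

/-- The continuous embedding `M^{s(·),p(·)} ↪ C^{0,α(·)}`: functions being identified when they
agree almost everywhere, every `u` has a representative in the Hölder space, with control of the
norms. -/
def EmbedsInHolder {X : Type*} [MetricSpace X] [MeasurableSpace X] (μ : Measure X)
    (s p α : X → ℝ) : Prop :=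
  ∃ C : ℝ≥0, ∀ u : X → ℝ, MemHajlasz μ s p u →
    ∃ v : X → ℝ, u =ᵐ[μ] v ∧ MemHolder α v ∧ holderNorm α v ≤ C * hajlaszNorm μ s p u

end VarHajlasz

end

/-!
Normalise `u` so that `|u|` and a gradient `g` have modular at most one and let
`H = |u| ^ p + g ^ p`, so that `∫ H ≤ 2`. The lower bound on the measure of balls provides, near
every point `x` and at every small scale `ρ`, a point where `H ≲ ρ ^ (-Q x)`. Telescoping the
gradient inequality along such points at dyadic scales bounds the increments of `u` by a geometric
series with terms `ρ ^ (s x - Q x / p x)`; log-Hölder continuity of the exponents is what allows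
all of them to be evaluated at one point.

If `s < Q / p`, the series is dominated by its smallest scale, where `ρ ^ (-Q x) ≈ H x`, and gives
the pointwise estimate `|u x| ^ τ ≤ C * H x` with `τ` up to the critical exponent; at criticality
the same estimate holds with `τ` arbitrarily large. Integrating it yields the Sobolev embedding.
If `s > Q / p`, the series is dominated by its largest scale, which is Hölder continuity on a
dense set.
-/

namespace VarHajlasz

/-- Two-sided *pointwise* bounds for an exponent, as opposed to the almost everywhere bounds of
`BoundedExponent`. Requiring both constants to be positive loses nothing and keeps the empty space
from being a special case. -/
def IsUniformExponent {X : Type*} (f : X → ℝ) : Prop :=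
  ∃ c > 0, ∃ C > 0, ∀ x, c ≤ f x ∧ f x ≤ C

namespace IsUniformExponent

variable {X : Type*} {f : X → ℝ}

lemma exists_pos_le (hf : IsUniformExponent f) : ∃ c > 0, ∀ x, c ≤ f x := by
  obtain ⟨c, hc, _, _, h⟩ := hf
  exact ⟨c, hc, fun x => (h x).1⟩

lemma exists_pos_ge (hf : IsUniformExponent f) : ∃ C > 0, ∀ x, f x ≤ C := by
  obtain ⟨_, _, C, hC, h⟩ := hf
  exact ⟨C, hC, fun x => (h x).2⟩

lemma pos (hf : IsUniformExponent f) (x : X) : 0 < f x := by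
  obtain ⟨c, hc, h⟩ := hf.exists_pos_le
  exact hc.trans_le (h x)

end IsUniformExponent

section LogHolder

variable {X : Type*} [MetricSpace X] {f g : X → ℝ}

lemma one_le_log_exp_one_add_inv {d : ℝ} (hd : 0 < d) : 1 ≤ Real.log (Real.exp 1 + 1 / d) := by
  rw [Real.le_log_iff_exp_le (by positivity)]
  exact le_add_of_nonneg_right (by positivity)

lemma LogHolder.exists_abs_sub_mul_log_inv_le (hf : LogHolder f) :
    ∃ B > 0, ∀ (x y : X) (ρ : ℝ), 0 < ρ → dist x y ≤ ρ → |f x - f y| * Real.log ρ⁻¹ ≤ B := by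
  obtain ⟨C, hC, hf⟩ := hf
  refine ⟨C, hC, fun x y ρ hρ hxy => ?_⟩
  rcases eq_or_ne x y with rfl | hne
  · simpa using hC.le
  have hd : 0 < dist x y := dist_pos.2 hne
  have hlog : Real.log ρ⁻¹ ≤ Real.log (Real.exp 1 + 1 / dist x y) := by
    refine Real.log_le_log (by positivity) ?_
    calc ρ⁻¹ ≤ 1 / dist x y := by rw [one_div]; gcongr
      _ ≤ Real.exp 1 + 1 / dist x y := le_add_of_nonneg_left (Real.exp_pos 1).le
  calc |f x - f y| * Real.log ρ⁻¹
      ≤ |f x - f y| * Real.log (Real.exp 1 + 1 / dist x y) := by gcongr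
    _ ≤ C := (le_div_iff₀ (zero_lt_one.trans_le (one_le_log_exp_one_add_inv hd))).1 (hf x y hne)

lemma LogHolder.continuous (hf : LogHolder f) : Continuous f := by
  obtain ⟨B, hB, hf⟩ := hf.exists_abs_sub_mul_log_inv_le
  refine Metric.continuous_iff.2 fun x ε hε => ⟨Real.exp (-(2 * B / ε)), Real.exp_pos _, ?_⟩
  intro y hy
  have h := hf y x _ (Real.exp_pos _) hy.le
  rw [← Real.exp_neg, neg_neg, Real.log_exp, ← le_div_iff₀ (by positivity)] at h
  calc |f y - f x| ≤ B / (2 * B / ε) := h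
    _ = ε / 2 := by field_simp
    _ < ε := half_lt_self hε

lemma LogHolder.exists_rpow_le_mul_rpow (hf : LogHolder f) :
    ∃ C, 1 ≤ C ∧ ∀ (x y : X) (ρ : ℝ), 0 < ρ → ρ ≤ 1 → dist x y ≤ ρ → ρ ^ f x ≤ C * ρ ^ f y := by
  obtain ⟨B, hB, hf⟩ := hf.exists_abs_sub_mul_log_inv_le
  refine ⟨Real.exp B, Real.one_le_exp hB.le, fun x y ρ hρ hρ1 hxy => ?_⟩
  have hlog : 0 ≤ Real.log ρ⁻¹ := Real.log_nonneg ((one_le_inv₀ hρ).2 hρ1)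
  have hexp : Real.log ρ * f x ≤ B + Real.log ρ * f y :=
    calc Real.log ρ * f x = -(f x - f y) * Real.log ρ⁻¹ + Real.log ρ * f y := by
          rw [Real.log_inv]; ring
      _ ≤ |f x - f y| * Real.log ρ⁻¹ + Real.log ρ * f y := by gcongr; exact neg_le_abs _
      _ ≤ B + Real.log ρ * f y := by gcongr; exact hf x y ρ hρ hxy
  rw [Real.rpow_def_of_pos hρ, Real.rpow_def_of_pos hρ, ← Real.exp_add]
  exact Real.exp_le_exp.2 hexp

lemma LogHolder.neg (hf : LogHolder f) : LogHolder (fun x => -f x) := by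
  obtain ⟨C, hC, hf⟩ := hf
  refine ⟨C, hC, fun x y hne => ?_⟩
  rw [neg_sub_neg, abs_sub_comm]
  exact hf x y hne

lemma LogHolder.sub (hf : LogHolder f) (hg : LogHolder g) : LogHolder (fun x => f x - g x) := by
  obtain ⟨C, hC, hf⟩ := hf
  obtain ⟨C', hC', hg⟩ := hg
  refine ⟨C + C', by positivity, fun x y hne => ?_⟩
  calc |f x - g x - (f y - g y)| = |(f x - f y) - (g x - g y)| := by congr 1; ring
    _ ≤ |f x - f y| + |g x - g y| := abs_sub _ _
    _ ≤ (C + C') / Real.log (Real.exp 1 + 1 / dist x y) := by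
      rw [add_div]; exact add_le_add (hf x y hne) (hg x y hne)

lemma LogHolder.mul (hf : LogHolder f) (hg : LogHolder g) {A B : ℝ} (hA : 0 < A) (hB : 0 < B)
    (hfA : ∀ x, |f x| ≤ A) (hgB : ∀ x, |g x| ≤ B) : LogHolder (fun x => f x * g x) := by
  obtain ⟨C, hC, hf⟩ := hf
  obtain ⟨C', hC', hg⟩ := hg
  refine ⟨A * C' + B * C, by positivity, fun x y hne => ?_⟩
  calc |f x * g x - f y * g y| = |f x * (g x - g y) + g y * (f x - f y)| := by congr 1; ring
    _ ≤ |f x| * |g x - g y| + |g y| * |f x - f y| := by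
      rw [← abs_mul, ← abs_mul]; exact abs_add_le _ _
    _ ≤ A * (C' / Real.log (Real.exp 1 + 1 / dist x y)) +
          B * (C / Real.log (Real.exp 1 + 1 / dist x y)) := by
      gcongr
      exacts [hfA x, hg x y hne, hgB y, hf x y hne]
    _ = (A * C' + B * C) / Real.log (Real.exp 1 + 1 / dist x y) := by ring

lemma IsUniformExponent.logHolder_of_one_div (hf : IsUniformExponent f)
    (hfL : LogHolder (fun x => 1 / f x)) : LogHolder f := by
  obtain ⟨A, hA, hfA⟩ := hf.exists_pos_ge
  obtain ⟨C, hC, hfL⟩ := hfL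
  refine ⟨A * A * C, by positivity, fun x y hne => ?_⟩
  have hx := hf.pos x
  have hy := hf.pos y
  calc |f x - f y| = f x * f y * |1 / f x - 1 / f y| := by
        rw [← abs_of_pos (mul_pos hx hy), ← abs_mul, abs_sub_comm]
        congr 1
        field_simp
    _ ≤ A * A * (C / Real.log (Real.exp 1 + 1 / dist x y)) := by
      gcongr
      exacts [hfA x, hfA y, hfL x y hne]
    _ = A * A * C / Real.log (Real.exp 1 + 1 / dist x y) := by ring

end LogHolder

/-- The standing assumptions on the lower dimension `Q`, the integrability exponent `p` and the
smoothness exponent `s` under which the telescoping argument runs. -/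
structure IsAdmissibleTriple {X : Type*} [MetricSpace X] (Q p s : X → ℝ) : Prop where
  dim : IsUniformExponent Q
  exponent : IsUniformExponent p
  smoothness : IsUniformExponent s
  logHolder_exponent : LogHolder (fun x => 1 / p x)
  logHolder_smoothness : LogHolder s

/-- `H` is an energy density of `u` on `D`: its power `H ^ (1 / p)` dominates `|u|` and is an
`s`-gradient of `u`, and around every centre, at every scale `ρ ≤ ρ₀`, there is a point of `D` at
which `H` is at most `Λ * ρ ^ (-Q)`. With `H = |u| ^ p + g ^ p` the last property is what remains
of the lower bound on the measure of balls once `H` has been averaged over them. -/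
structure IsEnergyDensity {X : Type*} [MetricSpace X] (D : Set X) (Q p s : X → ℝ) (Λ ρ₀ : ℝ)
    (u H : X → ℝ) : Prop where
  nonneg : ∀ x, 0 ≤ H x
  abs_le : ∀ x ∈ D, |u x| ≤ H x ^ (1 / p x)
  abs_sub_le : ∀ x ∈ D, ∀ y ∈ D,
    |u x - u y| ≤ dist x y ^ s x * H x ^ (1 / p x) + dist x y ^ s y * H y ^ (1 / p y)
  exists_near : ∀ x ρ, 0 < ρ → ρ ≤ ρ₀ → ∃ y ∈ D, dist x y ≤ ρ ∧ H y ≤ Λ * ρ ^ (-Q x)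

section Telescoping

variable {X : Type*} [MetricSpace X] {D : Set X} {Q p s u H : X → ℝ} {Λ Λ' ρ₀ ρ₁ : ℝ}

lemma IsEnergyDensity.mono (hH : IsEnergyDensity D Q p s Λ ρ₀ u H) (hΛ : Λ ≤ Λ')
    (hρ : ρ₁ ≤ ρ₀) : IsEnergyDensity D Q p s Λ' ρ₁ u H where
  nonneg := hH.nonneg
  abs_le := hH.abs_le
  abs_sub_le := hH.abs_sub_le
  exists_near x ρ hρ0 hρ1 := by
    obtain ⟨y, hy, hxy, hHy⟩ := hH.exists_near x ρ hρ0 (hρ1.trans hρ)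
    exact ⟨y, hy, hxy, hHy.trans (by gcongr)⟩

lemma IsEnergyDensity.dense (hH : IsEnergyDensity D Q p s Λ ρ₀ u H) (hρ₀ : 0 < ρ₀) : Dense D := by
  refine Metric.dense_iff.2 fun x r hr => ?_
  obtain ⟨y, hy, hxy, -⟩ := hH.exists_near x (min (r / 2) ρ₀) (by positivity) (min_le_right _ _)
  refine ⟨y, ?_, hy⟩
  rw [mem_ball, dist_comm]
  exact hxy.trans_lt ((min_le_left _ _).trans_lt (half_lt_self hr))

lemma IsEnergyDensity.abs_le_rpow_of_le (hH : IsEnergyDensity D Q p s Λ ρ₀ u H) {c M : ℝ}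
    (hc : 0 < c) (hcp : ∀ x, c ≤ p x) (hM : 1 ≤ M) {x : X} (hx : x ∈ D) (hHM : H x ≤ M) :
    |u x| ≤ M ^ (1 / c) := by
  have hp : 0 < p x := hc.trans_le (hcp x)
  calc |u x| ≤ H x ^ (1 / p x) := hH.abs_le x hx
    _ ≤ M ^ (1 / p x) := Real.rpow_le_rpow (hH.nonneg x) hHM (by positivity)
    _ ≤ M ^ (1 / c) :=
      Real.rpow_le_rpow_of_exponent_le hM (one_div_le_one_div_of_le hc (hcp x))

lemma rpow_neg_le_two_rpow_mul {t q K : ℝ} (ht : 0 < t) (hqK : q ≤ K) :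
    t ^ (-q) ≤ 2 ^ K * (2 * t) ^ (-q) :=
  calc t ^ (-q) = 2 ^ q * (2 * t) ^ (-q) := by
        rw [Real.mul_rpow zero_le_two ht.le, ← mul_assoc, ← Real.rpow_add two_pos,
          add_neg_cancel, Real.rpow_zero, one_mul]
    _ ≤ 2 ^ K * (2 * t) ^ (-q) := by
        gcongr
        exact one_le_two

lemma exists_rpow_le_mul_rpow_of_le_two_mul (hs : IsUniformExponent s) (hsL : LogHolder s) :
    ∃ C > 0, ∀ (x y : X) (ρ d : ℝ), 0 < ρ → ρ ≤ 1 → dist x y ≤ ρ → 0 ≤ d → d ≤ 2 * ρ →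
      d ^ s y ≤ C * ρ ^ s x := by
  obtain ⟨S, -, hsS⟩ := hs.exists_pos_ge
  obtain ⟨B, hB, hBs⟩ := hsL.exists_rpow_le_mul_rpow
  refine ⟨2 ^ S * B, by positivity, fun x y ρ d hρ hρ1 hxy hd hdρ => ?_⟩
  calc d ^ s y ≤ (2 * ρ) ^ s y := Real.rpow_le_rpow hd hdρ (hs.pos y).le
    _ = 2 ^ s y * ρ ^ s y := Real.mul_rpow zero_le_two hρ.le
    _ ≤ 2 ^ S * (B * ρ ^ s x) := by
      gcongr
      exacts [one_le_two, hsS y, hBs y x ρ hρ hρ1 (dist_comm x y ▸ hxy)]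
    _ = 2 ^ S * B * ρ ^ s x := by ring

lemma exists_rpow_one_div_le_mul_rpow (hQ : IsUniformExponent Q) (hp : IsUniformExponent p)
    (hpL : LogHolder (fun x => 1 / p x)) (hΛ : 1 ≤ Λ) :
    ∃ C > 0, ∀ (x y : X) (ρ h : ℝ), 0 < ρ → ρ ≤ 1 → dist x y ≤ ρ → 0 ≤ h →
      h ≤ Λ * ρ ^ (-Q x) → h ^ (1 / p y) ≤ C * ρ ^ (-(Q x / p x)) := by
  obtain ⟨B, hB, hBp⟩ := hpL.neg.exists_rpow_le_mul_rpow
  obtain ⟨c, hc, hcp⟩ := hp.exists_pos_le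
  obtain ⟨K, -, hQK⟩ := hQ.exists_pos_ge
  refine ⟨Λ ^ (1 / c) * B ^ K, by positivity, fun x y ρ h hρ hρ1 hxy hh hhΛ => ?_⟩
  have hpy : 0 < p y := hp.pos y
  have hpow : (ρ ^ (-Q x)) ^ (1 / p y) ≤ B ^ K * ρ ^ (-(Q x / p x)) :=
    calc (ρ ^ (-Q x)) ^ (1 / p y) = (ρ ^ (-(1 / p y))) ^ Q x := by
          rw [← Real.rpow_mul hρ.le, ← Real.rpow_mul hρ.le]; congr 1; ring
      _ ≤ (B * ρ ^ (-(1 / p x))) ^ Q x := by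
          gcongr
          exacts [(hQ.pos x).le, hBp y x ρ hρ hρ1 (dist_comm x y ▸ hxy)]
      _ = B ^ Q x * ρ ^ (-(Q x / p x)) := by
          rw [Real.mul_rpow (by positivity) (by positivity), ← Real.rpow_mul hρ.le]
          congr 2; ring
      _ ≤ B ^ K * ρ ^ (-(Q x / p x)) := by
          gcongr
          exact hQK x
  calc h ^ (1 / p y) ≤ (Λ * ρ ^ (-Q x)) ^ (1 / p y) := by gcongr
    _ = Λ ^ (1 / p y) * (ρ ^ (-Q x)) ^ (1 / p y) :=
        Real.mul_rpow (by positivity) (by positivity)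
    _ ≤ Λ ^ (1 / c) * (B ^ K * ρ ^ (-(Q x / p x))) := by
        gcongr
        exact hcp y
    _ = Λ ^ (1 / c) * B ^ K * ρ ^ (-(Q x / p x)) := by ring

lemma IsAdmissibleTriple.exists_abs_sub_le_of_near (hA : IsAdmissibleTriple Q p s) {M : ℝ}
    (hM : 1 ≤ M) :
    ∃ C > 0, ∀ {D : Set X} {u H : X → ℝ}, IsEnergyDensity D Q p s Λ ρ₀ u H →
      ∀ (x y z : X) (ρ : ℝ), y ∈ D → z ∈ D → 0 < ρ → ρ ≤ 1 → dist x y ≤ ρ → dist x z ≤ ρ →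
        H y ≤ M * ρ ^ (-Q x) → H z ≤ M * ρ ^ (-Q x) →
          |u y - u z| ≤ C * ρ ^ (s x - Q x / p x) := by
  obtain ⟨A, hA0, hdist⟩ :=
    exists_rpow_le_mul_rpow_of_le_two_mul hA.smoothness hA.logHolder_smoothness
  obtain ⟨B, hB0, henergy⟩ :=
    exists_rpow_one_div_le_mul_rpow hA.dim hA.exponent hA.logHolder_exponent hM
  refine ⟨2 * (A * B), by positivity, fun {D u H} hH x y z ρ hy hz hρ hρ1 hxy hxz hHy hHz => ?_⟩
  have hyz : dist y z ≤ 2 * ρ := by linarith [dist_triangle_left y z x]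
  have hterm (w : X) (hxw : dist x w ≤ ρ) (hHw : H w ≤ M * ρ ^ (-Q x)) :
      dist y z ^ s w * H w ^ (1 / p w) ≤ A * B * ρ ^ (s x - Q x / p x) :=
    calc dist y z ^ s w * H w ^ (1 / p w) ≤ A * ρ ^ s x * (B * ρ ^ (-(Q x / p x))) :=
          mul_le_mul (hdist x w ρ _ hρ hρ1 hxw dist_nonneg hyz)
            (henergy x w ρ _ hρ hρ1 hxw (hH.nonneg w) hHw)
            (Real.rpow_nonneg (hH.nonneg w) _) (by positivity)
      _ = A * B * ρ ^ (s x - Q x / p x) := by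
          rw [sub_eq_add_neg, Real.rpow_add hρ]; ring
  calc |u y - u z| ≤ dist y z ^ s y * H y ^ (1 / p y) + dist y z ^ s z * H z ^ (1 / p z) :=
        hH.abs_sub_le y hy z hz
    _ ≤ 2 * (A * B) * ρ ^ (s x - Q x / p x) := by linarith [hterm y hxy hHy, hterm z hxz hHz]

/-- All the intermediate points lie near the *same* centre `x`, so that only the exponents at `x`
enter the sum. -/
theorem IsAdmissibleTriple.exists_abs_sub_le_sum (hA : IsAdmissibleTriple Q p s) (hΛ : 1 ≤ Λ)
    (hρ₀ : ρ₀ ≤ 1) :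
    ∃ C > 0, ∀ {D : Set X} {u H : X → ℝ}, IsEnergyDensity D Q p s Λ ρ₀ u H →
      ∀ (x y : X) (r : ℝ) (m : ℕ), x ∈ D → y ∈ D → 0 < r → H x ≤ Λ * r ^ (-Q x) →
        2 ^ m * r ≤ ρ₀ → dist x y ≤ 2 ^ m * r → H y ≤ Λ * (2 ^ m * r) ^ (-Q x) →
          |u x - u y| ≤ C * ∑ j ∈ Finset.range (m + 1), (2 ^ j * r) ^ (s x - Q x / p x) := by
  obtain ⟨K, hK, hQK⟩ := hA.dim.exists_pos_ge
  have h2K : (1 : ℝ) ≤ 2 ^ K := Real.one_le_rpow one_le_two hK.le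
  obtain ⟨C, hC, hstep⟩ := hA.exists_abs_sub_le_of_near (Λ := Λ) (ρ₀ := ρ₀)
    (one_le_mul_of_one_le_of_one_le h2K hΛ)
  refine ⟨C, hC, fun {D u H} hH x y r m hx hy hr hHx hm hxy hHy => ?_⟩
  have hweaken {t h : ℝ} (ht : 0 ≤ t) (h_le : h ≤ Λ * t) : h ≤ 2 ^ K * Λ * t :=
    h_le.trans (by gcongr; exact le_mul_of_one_le_left (by positivity) h2K)
  induction m generalizing y with
  | zero =>
    simp only [pow_zero, one_mul] at hm hxy hHy
    simpa using hstep hH x x y r hx hy hr (hm.trans hρ₀) (by simpa using hr.le) hxy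
      (hweaken (by positivity) hHx) (hweaken (by positivity) hHy)
  | succ m ih =>
    have hdouble : (2 : ℝ) ^ (m + 1) * r = 2 * (2 ^ m * r) := by ring
    have hscale : (2 : ℝ) ^ m * r ≤ 2 ^ (m + 1) * r := by
      rw [hdouble]; exact le_mul_of_one_le_left (by positivity) one_le_two
    obtain ⟨z, hz, hxz, hHz⟩ := hH.exists_near x (2 ^ m * r) (by positivity) (hscale.trans hm)
    have hHz' : H z ≤ 2 ^ K * Λ * (2 ^ (m + 1) * r) ^ (-Q x) :=
      calc H z ≤ Λ * (2 ^ m * r) ^ (-Q x) := hHz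
        _ ≤ Λ * (2 ^ K * (2 * (2 ^ m * r)) ^ (-Q x)) := by
            gcongr
            exact rpow_neg_le_two_rpow_mul (by positivity) (hQK x)
        _ = 2 ^ K * Λ * (2 ^ (m + 1) * r) ^ (-Q x) := by rw [hdouble]; ring
    rw [Finset.sum_range_succ, mul_add]
    calc |u x - u y| ≤ |u x - u z| + |u z - u y| := _root_.abs_sub_le _ _ _
      _ ≤ _ := add_le_add (ih z hz (hscale.trans hm) hxz hHz)
        (hstep hH x z y _ hz hy (by positivity) (hm.trans hρ₀) (hxz.trans hscale) hxy hHz'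
          (hweaken (by positivity) hHy))

end Telescoping

section GeometricSums

variable {c e r : ℝ}

lemma sum_two_rpow_pow_le (hc : 0 < c) (he : e ≤ -c) (n : ℕ) :
    ∑ j ∈ Finset.range n, ((2 : ℝ) ^ e) ^ j ≤ 1 / (1 - 2 ^ (-c)) := by
  have hlt : (2 : ℝ) ^ (-c) < 1 := Real.rpow_lt_one_of_one_lt_of_neg one_lt_two (neg_lt_zero.2 hc)
  have hle : (2 : ℝ) ^ e ≤ 2 ^ (-c) := Real.rpow_le_rpow_of_exponent_le one_le_two he
  rw [le_div_iff₀ (sub_pos.2 hlt)]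
  calc (∑ j ∈ Finset.range n, ((2 : ℝ) ^ e) ^ j) * (1 - 2 ^ (-c))
      ≤ (∑ j ∈ Finset.range n, ((2 : ℝ) ^ e) ^ j) * (1 - 2 ^ e) := by gcongr
    _ = 1 - ((2 : ℝ) ^ e) ^ n := geom_sum_mul_neg _ _
    _ ≤ 1 := sub_le_self _ (by positivity)

lemma sum_two_pow_mul_rpow_le_of_le_neg (hr : 0 < r) (hc : 0 < c) (he : e ≤ -c) (n : ℕ) :
    ∑ j ∈ Finset.range n, ((2 : ℝ) ^ j * r) ^ e ≤ 1 / (1 - 2 ^ (-c)) * r ^ e := by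
  have hterm (j : ℕ) : ((2 : ℝ) ^ j * r) ^ e = ((2 : ℝ) ^ e) ^ j * r ^ e := by
    rw [Real.mul_rpow (by positivity) hr.le, Real.rpow_pow_comm zero_le_two]
  simp only [hterm, ← Finset.sum_mul]
  gcongr
  exact sum_two_rpow_pow_le hc he n

lemma sum_two_pow_mul_rpow_le_of_le (hr : 0 < r) (hc : 0 < c) (he : c ≤ e) (m : ℕ) :
    ∑ j ∈ Finset.range (m + 1), ((2 : ℝ) ^ j * r) ^ e ≤ 1 / (1 - 2 ^ (-c)) * (2 ^ m * r) ^ e := by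
  have hterm : ∀ j ∈ Finset.range (m + 1),
      ((2 : ℝ) ^ (m + 1 - 1 - j) * r) ^ e = ((2 : ℝ) ^ (-e)) ^ j * (2 ^ m * r) ^ e := by
    intro j hj
    rw [add_tsub_cancel_right, pow_sub₀ _ two_ne_zero (Finset.mem_range_succ_iff.1 hj),
      mul_right_comm, Real.mul_rpow (by positivity) (by positivity), mul_comm,
      Real.inv_rpow (by positivity), ← Real.rpow_pow_comm zero_le_two, Real.rpow_neg zero_le_two,
      inv_pow]
  rw [← Finset.sum_range_reflect, Finset.sum_congr rfl hterm, ← Finset.sum_mul]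
  gcongr
  exact sum_two_rpow_pow_le hc (neg_le_neg he) _

end GeometricSums

section TopScale

variable {X : Type*} [MetricSpace X] {Q p s : X → ℝ} {Λ ρ₀ : ℝ}

lemma one_le_mul_rpow_neg {K : ℝ} (hΛ : 1 ≤ Λ) (hρ₀ : 0 < ρ₀) (hρ₁ : ρ₀ ≤ 1) (hK : 0 ≤ K) :
    1 ≤ Λ * ρ₀ ^ (-K) :=
  one_le_mul_of_one_le_of_one_le hΛ
    (Real.one_le_rpow_of_pos_of_le_one_of_nonpos hρ₀ hρ₁ (neg_nonpos.2 hK))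

lemma rpow_neg_le_rpow_neg {a t q K : ℝ} (ha : 0 < a) (hat : a ≤ t) (ht : t ≤ 1) (hqK : q ≤ K)
    (hK : 0 ≤ K) : t ^ (-q) ≤ a ^ (-K) :=
  (Real.rpow_le_rpow_of_exponent_ge (ha.trans_le hat) ht (neg_le_neg hqK)).trans
    (Real.rpow_le_rpow_of_nonpos ha hat (neg_nonpos.2 hK))

lemma exists_abs_le_of_top_scale (hQ : IsUniformExponent Q) (hp : IsUniformExponent p)
    (hΛ : 1 ≤ Λ) (hρ₀ : 0 < ρ₀) (hρ₁ : ρ₀ ≤ 1) :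
    ∃ M, 1 ≤ M ∧ ∀ {D : Set X} {u H : X → ℝ}, IsEnergyDensity D Q p s Λ ρ₀ u H →
      ∀ (x y : X) (ρ : ℝ), y ∈ D → ρ₀ / 2 ≤ ρ → ρ ≤ ρ₀ → H y ≤ Λ * ρ ^ (-Q x) → |u y| ≤ M := by
  obtain ⟨K, hK, hQK⟩ := hQ.exists_pos_ge
  obtain ⟨c, hc, hcp⟩ := hp.exists_pos_le
  have hone : 1 ≤ Λ * (ρ₀ / 2) ^ (-K) :=
    one_le_mul_rpow_neg hΛ (half_pos hρ₀) ((half_le_self hρ₀.le).trans hρ₁) hK.le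
  refine ⟨(Λ * (ρ₀ / 2) ^ (-K)) ^ (1 / c), Real.one_le_rpow hone (by positivity), ?_⟩
  intro D u H hH x y ρ hy hρ hρρ₀ hHy
  refine hH.abs_le_rpow_of_le hc hcp hone hy (hHy.trans ?_)
  gcongr ?_ * ?_
  exact rpow_neg_le_rpow_neg (half_pos hρ₀) hρ (hρρ₀.trans hρ₁) (hQK x) hK.le

end TopScale

section PointwiseSobolev

variable {X : Type*} [MetricSpace X] {D : Set X} {Q p s u H : X → ℝ} {Λ ρ₀ T : ℝ}

lemma IsEnergyDensity.abs_rpow_le_of_le (hH : IsEnergyDensity D Q p s Λ ρ₀ u H) {c M τ : ℝ}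
    (hc : 0 < c) (hcp : ∀ x, c ≤ p x) (hM : 1 ≤ M) {x : X} (hx : x ∈ D) (hHM : H x ≤ M)
    (hpτ : p x ≤ τ) (hτT : τ ≤ T) : |u x| ^ τ ≤ M ^ (T / c) * H x := by
  have hp : 0 < p x := hc.trans_le (hcp x)
  have hτ : 0 < τ := hp.trans_le hpτ
  have hexp : 0 ≤ τ / p x - 1 := sub_nonneg.2 ((one_le_div hp).2 hpτ)
  have hexp_le : τ / p x - 1 ≤ T / c :=
    (sub_le_self _ zero_le_one).trans (div_le_div₀ (hτ.le.trans hτT) hτT hc (hcp x))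
  calc |u x| ^ τ ≤ (H x ^ (1 / p x)) ^ τ := by gcongr; exact hH.abs_le x hx
    _ = H x ^ (τ / p x - 1 + 1) := by
        rw [← Real.rpow_mul (hH.nonneg x)]; congr 1; ring
    _ = H x ^ (τ / p x - 1) * H x := by
        rw [Real.rpow_add_of_nonneg (hH.nonneg x) hexp zero_le_one, Real.rpow_one]
    _ ≤ M ^ (T / c) * H x := by
        gcongr
        · exact hH.nonneg x
        · exact (Real.rpow_le_rpow (hH.nonneg x) hHM hexp).trans
            (Real.rpow_le_rpow_of_exponent_le hM hexp_le)

lemma IsAdmissibleTriple.exists_abs_le_mul_rpow (hA : IsAdmissibleTriple Q p s) (hΛ : 1 ≤ Λ)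
    (hρ₀ : 0 < ρ₀) (hρ₁ : ρ₀ ≤ 1) (hT : 0 < T) :
    ∃ C, 1 ≤ C ∧ ∀ {D : Set X} {u H : X → ℝ}, IsEnergyDensity D Q p s Λ ρ₀ u H →
      ∀ (x : X) (r τ : ℝ), x ∈ D → 0 < r → r ≤ ρ₀ → H x ≤ Λ * r ^ (-Q x) → 0 < τ → τ ≤ T →
        -(Q x / τ) ≤ s x - Q x / p x → |u x| ≤ C * r ^ (-(Q x / τ)) := by
  obtain ⟨q, hq, hqQ⟩ := hA.dim.exists_pos_le
  obtain ⟨M, hM, htop⟩ := exists_abs_le_of_top_scale (s := s) hA.dim hA.exponent hΛ hρ₀ hρ₁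
  obtain ⟨A, hA0, hchain⟩ := hA.exists_abs_sub_le_sum hΛ hρ₁
  have hratio : 0 < 1 - (2 : ℝ) ^ (-(q / T)) :=
    sub_pos.2 (Real.rpow_lt_one_of_one_lt_of_neg one_lt_two (neg_lt_zero.2 (by positivity)))
  refine ⟨A * (1 / (1 - 2 ^ (-(q / T)))) + M, le_add_of_nonneg_of_le (by positivity) hM,
    fun {D u H} hH x r τ hx hr hrρ hHx hτ hτT hα => ?_⟩
  obtain ⟨m, hm, hm'⟩ := exists_nat_pow_near ((one_le_div hr).2 hrρ) one_lt_two
  rw [le_div_iff₀ hr] at hm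
  rw [div_lt_iff₀ hr, pow_succ'] at hm'
  obtain ⟨y, hy, hxy, hHy⟩ := hH.exists_near x (2 ^ m * r) (by positivity) hm
  have hsum : ∑ j ∈ Finset.range (m + 1), ((2 : ℝ) ^ j * r) ^ (s x - Q x / p x) ≤
      1 / (1 - 2 ^ (-(q / T))) * r ^ (-(Q x / τ)) := by
    refine (Finset.sum_le_sum fun j hj => ?_).trans (sum_two_pow_mul_rpow_le_of_le_neg hr
      (by positivity : 0 < q / T) (neg_le_neg (div_le_div₀ (hq.le.trans (hqQ x)) (hqQ x) hτ hτT)) _)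
    refine Real.rpow_le_rpow_of_exponent_ge (by positivity) ?_ hα
    refine le_trans ?_ (hm.trans hρ₁)
    gcongr
    exacts [one_le_two, Finset.mem_range_succ_iff.1 hj]
  have hone : 1 ≤ r ^ (-(Q x / τ)) := Real.one_le_rpow_of_pos_of_le_one_of_nonpos hr
    (hrρ.trans hρ₁) (neg_nonpos.2 (div_nonneg (hA.dim.pos x).le hτ.le))
  calc |u x| ≤ |u x - u y| + |u y| := by linarith [abs_sub_abs_le_abs_sub (u x) (u y)]
    _ ≤ A * (1 / (1 - 2 ^ (-(q / T))) * r ^ (-(Q x / τ))) + M * r ^ (-(Q x / τ)) := by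
        refine add_le_add ((hchain hH x y r m hx hy hr hHx hm hxy hHy).trans (by gcongr)) ?_
        exact (htop hH x y _ hy (by linarith) hm hHy).trans
          (le_mul_of_one_le_right (by positivity) hone)
    _ = (A * (1 / (1 - 2 ^ (-(q / T)))) + M) * r ^ (-(Q x / τ)) := by ring

lemma exists_le_mul_rpow_neg_eq {q h : ℝ} (hΛ : 0 < Λ) (hρ₀ : 0 < ρ₀) (hq : 0 < q)
    (hh : Λ * ρ₀ ^ (-q) ≤ h) : ∃ r, 0 < r ∧ r ≤ ρ₀ ∧ Λ * r ^ (-q) = h := by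
  have hhΛ : 0 < h / Λ := div_pos ((by positivity : 0 < Λ * ρ₀ ^ (-q)).trans_le hh) hΛ
  have hrpow : ((h / Λ) ^ (-q⁻¹)) ^ (-q) = h / Λ := by
    rw [← Real.rpow_mul hhΛ.le, neg_mul_neg, inv_mul_cancel₀ hq.ne', Real.rpow_one]
  have hr : 0 < (h / Λ) ^ (-q⁻¹) := Real.rpow_pos_of_pos hhΛ _
  refine ⟨_, hr, ?_, by rw [hrpow, mul_div_cancel₀ _ hΛ.ne']⟩
  rwa [← Real.rpow_le_rpow_iff_of_neg hρ₀ hr (neg_lt_zero.2 hq), hrpow, le_div_iff₀ hΛ, mul_comm]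

theorem IsAdmissibleTriple.exists_abs_rpow_le (hA : IsAdmissibleTriple Q p s) (hΛ : 1 ≤ Λ)
    (hρ₀ : 0 < ρ₀) (hρ₁ : ρ₀ ≤ 1) (hT : 0 < T) :
    ∃ C > 0, ∀ {D : Set X} {u H : X → ℝ}, IsEnergyDensity D Q p s Λ ρ₀ u H →
      ∀ (x : X) (τ : ℝ), x ∈ D → p x ≤ τ → τ ≤ T → -(Q x / τ) ≤ s x - Q x / p x →
        |u x| ^ τ ≤ C * H x := by
  obtain ⟨K, hK, hQK⟩ := hA.dim.exists_pos_ge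
  obtain ⟨c, hc, hcp⟩ := hA.exponent.exists_pos_le
  obtain ⟨A, hA1, hlarge⟩ := hA.exists_abs_le_mul_rpow hΛ hρ₀ hρ₁ hT
  have hM : 1 ≤ Λ * ρ₀ ^ (-K) := one_le_mul_rpow_neg hΛ hρ₀ hρ₁ hK.le
  refine ⟨max ((Λ * ρ₀ ^ (-K)) ^ (T / c)) (A ^ T), by positivity,
    fun {D u H} hH x τ hx hpτ hτT hα => ?_⟩
  have hτ : 0 < τ := (hA.exponent.pos x).trans_le hpτ
  rcases le_total (H x) (Λ * ρ₀ ^ (-Q x)) with hsmall | hbig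
  · have hHM : H x ≤ Λ * ρ₀ ^ (-K) := hsmall.trans <| by
      gcongr ?_ * ?_
      exact rpow_neg_le_rpow_neg hρ₀ le_rfl hρ₁ (hQK x) hK.le
    exact (hH.abs_rpow_le_of_le hc hcp hM hx hHM hpτ hτT).trans
      (mul_le_mul_of_nonneg_right (le_max_left _ _) (hH.nonneg x))
  obtain ⟨r, hr, hrρ, hrH⟩ :=
    exists_le_mul_rpow_neg_eq (zero_lt_one.trans_le hΛ) hρ₀ (hA.dim.pos x) hbig
  have hux : |u x| ≤ A * r ^ (-(Q x / τ)) :=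
    hlarge hH x r τ hx hr hrρ hrH.ge hτ hτT hα
  calc |u x| ^ τ ≤ (A * r ^ (-(Q x / τ))) ^ τ := by gcongr
    _ = A ^ τ * r ^ (-Q x) := by
        rw [Real.mul_rpow (by positivity) (by positivity), ← Real.rpow_mul hr.le]
        congr 2; field_simp
    _ ≤ A ^ T * H x := by
        gcongr
        exact hrH ▸ le_mul_of_one_le_left (by positivity) hΛ
    _ ≤ max ((Λ * ρ₀ ^ (-K)) ^ (T / c)) (A ^ T) * H x :=
        mul_le_mul_of_nonneg_right (le_max_right _ _) (hH.nonneg x)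

end PointwiseSobolev

section PointwiseMorrey

variable {X : Type*} [MetricSpace X] {Q p s : X → ℝ} {Λ ρ₀ c : ℝ}

lemma IsAdmissibleTriple.logHolder_sub_div (hA : IsAdmissibleTriple Q p s) (hQL : LogHolder Q) :
    LogHolder (fun x => s x - Q x / p x) := by
  obtain ⟨K, hK, hQK⟩ := hA.dim.exists_pos_ge
  obtain ⟨a, ha, hap⟩ := hA.exponent.exists_pos_le
  have hmul : LogHolder (fun x => Q x * (1 / p x)) := by
    refine hQL.mul hA.logHolder_exponent hK (one_div_pos.2 ha) (fun x => ?_) fun x => ?_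
    · rw [abs_of_pos (hA.dim.pos x)]
      exact hQK x
    · rw [abs_of_pos (one_div_pos.2 (hA.exponent.pos x))]
      exact one_div_le_one_div_of_le ha (hap x)
  simpa only [mul_one_div] using hA.logHolder_smoothness.sub hmul

lemma IsAdmissibleTriple.sub_div_le (hA : IsAdmissibleTriple Q p s) (x : X) :
    s x - Q x / p x ≤ s x :=
  sub_le_self _ (div_pos (hA.dim.pos x) (hA.exponent.pos x)).le

lemma IsAdmissibleTriple.exists_pos_le_sub_div (hA : IsAdmissibleTriple Q p s) (hc : 0 < c)
    (hgap : ∀ x, c ≤ s x * p x - Q x) : ∃ a > 0, ∀ x, a ≤ s x - Q x / p x := by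
  obtain ⟨P, hP, hpP⟩ := hA.exponent.exists_pos_ge
  refine ⟨c / P, by positivity, fun x => ?_⟩
  have hpx := hA.exponent.pos x
  calc c / P ≤ (s x * p x - Q x) / p x := div_le_div₀ (hc.le.trans (hgap x)) (hgap x) hpx (hpP x)
    _ = s x - Q x / p x := by rw [sub_div, mul_div_cancel_right₀ _ hpx.ne']

lemma IsAdmissibleTriple.isUniformExponent_sub_div (hA : IsAdmissibleTriple Q p s) (hc : 0 < c)
    (hα : ∀ x, c ≤ s x - Q x / p x) : IsUniformExponent (fun x => s x - Q x / p x) := by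
  obtain ⟨S, hS, hsS⟩ := hA.smoothness.exists_pos_ge
  exact ⟨c, hc, S, hS, fun x => ⟨hα x, (hA.sub_div_le x).trans (hsS x)⟩⟩

lemma IsAdmissibleTriple.exists_abs_sub_le_mul_rpow (hA : IsAdmissibleTriple Q p s) (hΛ : 1 ≤ Λ)
    (hρ₁ : ρ₀ ≤ 1) (hc : 0 < c) (hα : ∀ x, c ≤ s x - Q x / p x) :
    ∃ C > 0, ∀ {D : Set X} {u H : X → ℝ}, IsEnergyDensity D Q p s Λ ρ₀ u H →
      ∀ (x y : X) (ρ : ℝ), x ∈ D → y ∈ D → 0 < ρ → ρ ≤ ρ₀ → dist x y ≤ ρ →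
        H y ≤ Λ * ρ ^ (-Q x) → |u x - u y| ≤ C * ρ ^ (s x - Q x / p x) := by
  obtain ⟨C, hC, hchain⟩ := hA.exists_abs_sub_le_sum hΛ hρ₁
  have hratio : 0 < 1 - (2 : ℝ) ^ (-c) :=
    sub_pos.2 (Real.rpow_lt_one_of_one_lt_of_neg one_lt_two (neg_lt_zero.2 hc))
  refine ⟨C * (1 / (1 - 2 ^ (-c))), by positivity, ?_⟩
  intro D u H hH x y ρ hx hy hρ hρρ₀ hxy hHy
  have hQ := hA.dim.pos x
  have hHx : 0 ≤ H x / Λ := div_nonneg (hH.nonneg x) (by positivity)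
  obtain ⟨m, hm⟩ := pow_unbounded_of_one_lt ((H x / Λ) ^ (Q x)⁻¹ * ρ) (one_lt_two (α := ℝ))
  have hρm : 2 ^ m * (ρ / 2 ^ m) = ρ := by field_simp
  have hHx_le : H x ≤ Λ * (ρ / 2 ^ m) ^ (-Q x) := by
    rw [Real.rpow_neg (by positivity), ← Real.inv_rpow (by positivity), inv_div, mul_comm,
      ← div_le_iff₀ (by positivity)]
    calc H x / Λ = ((H x / Λ) ^ (Q x)⁻¹) ^ Q x := (Real.rpow_inv_rpow hHx hQ.ne').symm
      _ ≤ (2 ^ m / ρ) ^ Q x := by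
          gcongr
          exact (le_div_iff₀ hρ).2 hm.le
  calc |u x - u y|
      ≤ C * ∑ j ∈ Finset.range (m + 1), (2 ^ j * (ρ / 2 ^ m)) ^ (s x - Q x / p x) := by
        refine hchain hH x y _ m hx hy (by positivity) hHx_le ?_ ?_ ?_ <;> rwa [hρm]
    _ ≤ C * (1 / (1 - 2 ^ (-c)) * ρ ^ (s x - Q x / p x)) := by
        gcongr
        simpa only [hρm] using
          sum_two_pow_mul_rpow_le_of_le (r := ρ / 2 ^ m) (by positivity) hc (hα x) m
    _ = C * (1 / (1 - 2 ^ (-c))) * ρ ^ (s x - Q x / p x) := by ring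

lemma IsAdmissibleTriple.exists_abs_le (hA : IsAdmissibleTriple Q p s) (hΛ : 1 ≤ Λ)
    (hρ₀ : 0 < ρ₀) (hρ₁ : ρ₀ ≤ 1) (hc : 0 < c) (hα : ∀ x, c ≤ s x - Q x / p x) :
    ∃ C > 0, ∀ {D : Set X} {u H : X → ℝ}, IsEnergyDensity D Q p s Λ ρ₀ u H →
      ∀ x ∈ D, |u x| ≤ C := by
  obtain ⟨M, hM, htop⟩ := exists_abs_le_of_top_scale (s := s) hA.dim hA.exponent hΛ hρ₀ hρ₁
  obtain ⟨C, hC, hscale⟩ := hA.exists_abs_sub_le_mul_rpow hΛ hρ₁ hc hα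
  refine ⟨C + M, by positivity, fun {D u H} hH x hx => ?_⟩
  obtain ⟨y, hy, hxy, hHy⟩ := hH.exists_near x ρ₀ hρ₀ le_rfl
  have hpow : ρ₀ ^ (s x - Q x / p x) ≤ 1 := Real.rpow_le_one hρ₀.le hρ₁ (hc.le.trans (hα x))
  calc |u x| ≤ |u x - u y| + |u y| := by linarith [abs_sub_abs_le_abs_sub (u x) (u y)]
    _ ≤ C * ρ₀ ^ (s x - Q x / p x) + M :=
        add_le_add (hscale hH x y ρ₀ hx hy hρ₀ le_rfl hxy hHy)
          (htop hH x y ρ₀ hy (half_le_self hρ₀.le) le_rfl hHy)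
    _ ≤ C + M := by gcongr; exact mul_le_of_le_one_right hC.le hpow

lemma IsAdmissibleTriple.exists_abs_sub_le_mul_dist_rpow_of_dist_le
    (hA : IsAdmissibleTriple Q p s) (hQL : LogHolder Q) (hΛ : 1 ≤ Λ) (hρ₁ : ρ₀ ≤ 1) (hc : 0 < c)
    (hα : ∀ x, c ≤ s x - Q x / p x) :
    ∃ C > 0, ∀ {D : Set X} {u H : X → ℝ}, IsEnergyDensity D Q p s Λ ρ₀ u H →
      ∀ x ∈ D, ∀ y ∈ D, x ≠ y → dist x y ≤ ρ₀ / 2 →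
        |u x - u y| ≤ C * dist x y ^ (s x - Q x / p x) := by
  obtain ⟨K, hK, hQK⟩ := hA.dim.exists_pos_ge
  obtain ⟨A, hA1, hQcomp⟩ := hQL.neg.exists_rpow_le_mul_rpow
  obtain ⟨B, hB, hαcomp⟩ := exists_rpow_le_mul_rpow_of_le_two_mul
    (hA.isUniformExponent_sub_div hc hα) (hA.logHolder_sub_div hQL)
  have hfactor : 1 ≤ A * 2 ^ K :=
    one_le_mul_of_one_le_of_one_le hA1 (Real.one_le_rpow one_le_two hK.le)
  have hΛ' : Λ ≤ Λ * (A * 2 ^ K) := le_mul_of_one_le_right (by positivity) hfactor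
  obtain ⟨C, hC, hscale⟩ := hA.exists_abs_sub_le_mul_rpow (hΛ.trans hΛ') hρ₁ hc hα
  refine ⟨C + C * B, by positivity, fun {D u H} hH x hx y hy hne hxy => ?_⟩
  set d := dist x y
  have hd : 0 < d := dist_pos.2 hne
  obtain ⟨z, hz, hxz, hHz⟩ := hH.exists_near x d hd (by linarith)
  have hyz : dist y z ≤ 2 * d := by linarith [dist_triangle_left y z x]
  have hHz' : H z ≤ Λ * (A * 2 ^ K) * (2 * d) ^ (-Q y) :=
    calc H z ≤ Λ * (A * d ^ (-Q y)) := hHz.trans <| by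
          gcongr
          exact hQcomp x y d hd (by linarith) le_rfl
      _ ≤ Λ * (A * (2 ^ K * (2 * d) ^ (-Q y))) := by
          gcongr
          exact rpow_neg_le_two_rpow_mul hd (hQK y)
      _ = Λ * (A * 2 ^ K) * (2 * d) ^ (-Q y) := by ring
  have hHΛ := hH.mono hΛ' le_rfl
  have hxz_le : |u x - u z| ≤ C * d ^ (s x - Q x / p x) :=
    hscale hHΛ x z d hx hz hd (by linarith) hxz (hHz.trans (by gcongr))
  have hyz_le : |u y - u z| ≤ C * (2 * d) ^ (s y - Q y / p y) :=
    hscale hHΛ y z (2 * d) hy hz (by positivity) (by linarith) hyz hHz'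
  calc |u x - u y| ≤ |u x - u z| + |u y - u z| := by
        rw [abs_sub_comm (u y)]; exact _root_.abs_sub_le _ _ _
    _ ≤ C * d ^ (s x - Q x / p x) + C * (B * d ^ (s x - Q x / p x)) := by
        refine add_le_add hxz_le (hyz_le.trans ?_)
        gcongr
        exact hαcomp x y d (2 * d) hd (by linarith) le_rfl (by positivity) le_rfl
    _ = (C + C * B) * d ^ (s x - Q x / p x) := by ring

theorem IsAdmissibleTriple.exists_abs_sub_le_mul_dist_rpow (hA : IsAdmissibleTriple Q p s)
    (hQL : LogHolder Q) (hΛ : 1 ≤ Λ) (hρ₀ : 0 < ρ₀) (hρ₁ : ρ₀ ≤ 1) (hc : 0 < c)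
    (hα : ∀ x, c ≤ s x - Q x / p x) :
    ∃ C > 0, ∀ {D : Set X} {u H : X → ℝ}, IsEnergyDensity D Q p s Λ ρ₀ u H →
      ∀ x ∈ D, ∀ y ∈ D, |u x - u y| ≤ C * dist x y ^ (s x - Q x / p x) := by
  obtain ⟨S, -, hsS⟩ := hA.smoothness.exists_pos_ge
  obtain ⟨A, -, hsup⟩ := hA.exists_abs_le hΛ hρ₀ hρ₁ hc hα
  obtain ⟨B, hB, hnear⟩ :=
    hA.exists_abs_sub_le_mul_dist_rpow_of_dist_le hQL hΛ hρ₁ hc hα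
  refine ⟨max B (2 * A * (ρ₀ / 2) ^ (-S)), by positivity, fun {D u H} hH x hx y hy => ?_⟩
  rcases eq_or_ne x y with rfl | hne
  · rw [sub_self, abs_zero]
    positivity
  have hd : 0 < dist x y := dist_pos.2 hne
  rcases le_total (dist x y) (ρ₀ / 2) with hle | hge
  · exact (hnear hH x hx y hy hne hle).trans (by gcongr; exact le_max_left _ _)
  have hhalf : 0 < ρ₀ / 2 := half_pos hρ₀
  have hpow : (ρ₀ / 2) ^ S ≤ dist x y ^ (s x - Q x / p x) :=
    calc (ρ₀ / 2) ^ S ≤ (ρ₀ / 2) ^ (s x - Q x / p x) :=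
          Real.rpow_le_rpow_of_exponent_ge hhalf (by linarith)
            ((hA.sub_div_le x).trans (hsS x))
      _ ≤ dist x y ^ (s x - Q x / p x) := Real.rpow_le_rpow hhalf.le hge (hc.le.trans (hα x))
  calc |u x - u y| ≤ |u x| + |u y| := abs_sub _ _
    _ ≤ 2 * A := by linarith [hsup hH x hx, hsup hH y hy]
    _ = 2 * A * (ρ₀ / 2) ^ (-S) * (ρ₀ / 2) ^ S := by
        rw [mul_assoc, ← Real.rpow_add hhalf, neg_add_cancel, Real.rpow_zero, mul_one]
    _ ≤ max B (2 * A * (ρ₀ / 2) ^ (-S)) * dist x y ^ (s x - Q x / p x) := by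
        gcongr
        exact le_max_right _ _

end PointwiseMorrey

lemma exists_continuous_extension_of_dense {X : Type*} [MetricSpace X] {D : Set X} {u α : X → ℝ}
    {c A C : ℝ} (hD : Dense D) (hα : Continuous α) (hc : 0 < c) (hcα : ∀ x, c ≤ α x) (hC : 0 < C)
    (hA : ∀ x ∈ D, |u x| ≤ A) (hu : ∀ x ∈ D, ∀ y ∈ D, |u x - u y| ≤ C * dist x y ^ α x) :
    ∃ v : X → ℝ, Continuous v ∧ (∀ x ∈ D, v x = u x) ∧ (∀ x, |v x| ≤ A) ∧
      ∀ x y, |v x - v y| ≤ C * dist x y ^ α x := by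
  have huc : UniformContinuous (fun x : D => u x) := by
    refine Metric.uniformContinuous_iff.2 fun ε hε =>
      ⟨min 1 ((ε / C) ^ (1 / c)), by positivity, fun {x y} hxy => ?_⟩
    calc |u x - u y| ≤ C * dist (x : X) y ^ α x := hu x x.2 y y.2
      _ ≤ C * dist (x : X) y ^ c := by
          gcongr C * ?_
          exact Real.rpow_le_rpow_of_exponent_ge' dist_nonneg (hxy.trans_le (min_le_left _ _)).le
            hc.le (hcα x)
      _ < C * ((ε / C) ^ (1 / c)) ^ c := by
          gcongr
          exact hxy.trans_le (min_le_right _ _)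
      _ = ε := by
          rw [← Real.rpow_mul (by positivity), one_div_mul_cancel hc.ne', Real.rpow_one]
          field_simp
  have hv : Continuous (hD.extend fun x : D => u x) :=
    (hD.uniformContinuous_extend huc).continuous
  have hvu (x : D) : hD.extend (fun x : D => u x) x = u x := hD.extend_of_ind huc x
  refine ⟨_, hv, fun x hx => hvu ⟨x, hx⟩, ?_, ?_⟩
  · refine isClosed_property hD.denseRange_val (isClosed_le hv.abs continuous_const) fun x => ?_
    rw [hvu]
    exact hA x x.2
  · refine isClosed_property2 hD.denseRange_val (isClosed_le (by fun_prop) ?_) fun x y => ?_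
    · exact continuous_const.mul (continuous_dist.rpow (hα.comp continuous_fst)
        fun z => Or.inr (hc.trans_le (hcα z.1)))
    · rw [hvu, hvu]
      exact hu x x.2 y y.2

section Modular

variable {X : Type*} [MeasurableSpace X] {μ : Measure X} {p : X → ℝ}

lemma modular_mono (hp : ∀ x, 0 ≤ p x) {f g : X → ℝ≥0∞} (hfg : ∀ x, f x ≤ g x) :
    modular μ p f ≤ modular μ p g :=
  lintegral_mono fun x => ENNReal.rpow_le_rpow (hfg x) (hp x)

lemma modular_const_mul_le (hp : ∀ x, 0 ≤ p x) {a : ℝ≥0∞} {K : ℝ≥0}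
    (haK : ∀ᵐ x ∂μ, a ^ p x ≤ K) (f : X → ℝ≥0∞) :
    modular μ p (fun x => a * f x) ≤ K * modular μ p f := by
  rw [modular, modular, ← lintegral_const_mul' _ _ ENNReal.coe_ne_top]
  refine lintegral_mono_ae ?_
  filter_upwards [haK] with x hx
  rw [ENNReal.mul_rpow_of_nonneg _ _ (hp x)]
  gcongr

lemma modular_lt_top_of_div (hp : ∀ x, 0 ≤ p x) {T : ℝ} (hT : ∀ᵐ x ∂μ, p x ≤ T) {l : ℝ≥0}
    (hl : 0 < l) {f : X → ℝ≥0∞} (hf : modular μ p (fun x => f x / l) < ∞) :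
    modular μ p f < ∞ := by
  have hpow : ∀ᵐ x ∂μ, (l : ℝ≥0∞) ^ p x ≤ (max l 1 ^ T : ℝ≥0) := by
    filter_upwards [hT] with x hx
    rw [← ENNReal.coe_rpow_of_nonneg _ (hp x), ENNReal.coe_le_coe]
    exact (NNReal.rpow_le_rpow (le_max_left _ _) (hp x)).trans
      (NNReal.rpow_le_rpow_of_exponent_le (le_max_right _ _) hx)
  have hcancel : f = fun x => l * (f x / l) := funext fun x =>
    (ENNReal.mul_div_cancel (ENNReal.coe_ne_zero.2 hl.ne') ENNReal.coe_ne_top).symm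
  rw [hcancel]
  exact (modular_const_mul_le hp hpow _).trans_lt (ENNReal.mul_lt_top ENNReal.coe_lt_top hf)

lemma modular_div_le_one_of_luxNorm_lt (hp : ∀ x, 0 ≤ p x) {f : X → ℝ≥0∞} {l : ℝ≥0}
    (hf : luxNorm μ p f < l) : modular μ p (fun x => f x / l) ≤ 1 := by
  simp only [luxNorm, iInf_lt_iff] at hf
  obtain ⟨l', -, hmod, hl'⟩ := hf
  exact (modular_mono hp fun x => ENNReal.div_le_div_left hl'.le _).trans hmod

lemma exists_luxNorm_le_mul (hp : ∀ x, 0 ≤ p x) {c : ℝ} (hc : 0 < c) (hcp : ∀ᵐ x ∂μ, c ≤ p x)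
    (M : ℝ≥0) :
    ∃ L : ℝ≥0, 0 < L ∧ ∀ (f : X → ℝ≥0∞) (l : ℝ≥0), 0 < l →
      modular μ p (fun x => f x / l) ≤ M → luxNorm μ p f ≤ L * l := by
  set M' : ℝ≥0 := max M 1
  have hM' : 0 < M' := zero_lt_one.trans_le (le_max_right _ _)
  have hL1 : 1 ≤ M' ^ (1 / c) := NNReal.one_le_rpow (le_max_right _ _) (by positivity)
  refine ⟨M' ^ (1 / c), zero_lt_one.trans_le hL1, fun f l hl hf => ?_⟩
  have hpow : ∀ᵐ x ∂μ, (((M' ^ (1 / c))⁻¹ : ℝ≥0) : ℝ≥0∞) ^ p x ≤ (M'⁻¹ : ℝ≥0) := by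
    filter_upwards [hcp] with x hx
    rw [← ENNReal.coe_rpow_of_nonneg _ (hp x), ENNReal.coe_le_coe, NNReal.inv_rpow]
    gcongr
    calc M' = (M' ^ (1 / c)) ^ c := by
          rw [← NNReal.rpow_mul, one_div_mul_cancel hc.ne', NNReal.rpow_one]
      _ ≤ (M' ^ (1 / c)) ^ p x := NNReal.rpow_le_rpow_of_exponent_le hL1 hx
  have hmod : modular μ p (fun x => f x / (M' ^ (1 / c) * l : ℝ≥0)) ≤ 1 :=
    calc modular μ p (fun x => f x / (M' ^ (1 / c) * l : ℝ≥0))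
        = modular μ p (fun x => ((M' ^ (1 / c))⁻¹ : ℝ≥0) * (f x / l)) := by
          congr 1 with x
          rw [ENNReal.coe_inv (by positivity), ENNReal.coe_mul, ENNReal.div_eq_inv_mul,
            ENNReal.div_eq_inv_mul, ← mul_assoc,
            ENNReal.mul_inv (Or.inr ENNReal.coe_ne_top) (Or.inl ENNReal.coe_ne_top)]
      _ ≤ (M'⁻¹ : ℝ≥0) * M' :=
          (modular_const_mul_le hp hpow _).trans (mul_le_mul_right
            (hf.trans (ENNReal.coe_le_coe.2 (le_max_left _ _))) _)
      _ = 1 := by rw [← ENNReal.coe_mul, inv_mul_cancel₀ hM'.ne', ENNReal.coe_one]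
  calc luxNorm μ p f ≤ (M' ^ (1 / c) * l : ℝ≥0) :=
        iInf₂_le_of_le _ (by positivity) (iInf_le _ hmod)
    _ = (M' ^ (1 / c) : ℝ≥0) * l := ENNReal.coe_mul _ _

end Modular

section HajlaszNorm

variable {X : Type*} [MetricSpace X] [MeasurableSpace X] {μ : Measure X} {p s u : X → ℝ}

lemma MemHajlasz.hajlaszNorm_lt_top (hp : ∀ x, 0 ≤ p x) {c : ℝ} (hc : 0 < c)
    (hcp : ∀ᵐ x ∂μ, c ≤ p x) (hu : MemHajlasz μ s p u) : hajlaszNorm μ s p u < ∞ := by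
  obtain ⟨⟨-, hmod⟩, hsemi⟩ := hu
  obtain ⟨L, -, hL⟩ := exists_luxNorm_le_mul hp hc hcp (modular μ p fun x => ‖u x‖ₑ).toNNReal
  refine ENNReal.add_lt_top.2 ⟨(hL _ 1 one_pos ?_).trans_lt ?_, hsemi⟩
  · simp only [ENNReal.coe_one, div_one, ENNReal.coe_toNNReal hmod.ne, le_refl]
  · exact ENNReal.mul_lt_top ENNReal.coe_lt_top ENNReal.coe_lt_top

lemma exists_gradient_of_hajlaszNorm_lt (hp : ∀ x, 0 ≤ p x) {l : ℝ≥0}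
    (hu : hajlaszNorm μ s p u < l) :
    modular μ p (fun x => ‖u x‖ₑ / l) ≤ 1 ∧
      ∃ g : X → ℝ≥0∞, AEMeasurable g μ ∧ IsScalarGradient μ s u g ∧
        modular μ p (fun x => g x / l) ≤ 1 := by
  refine ⟨modular_div_le_one_of_luxNorm_lt hp (le_self_add.trans_lt hu), ?_⟩
  have hsemi : hajlaszSeminorm μ s p u < l := le_add_self.trans_lt hu
  simp only [hajlaszSeminorm, iInf_lt_iff] at hsemi
  obtain ⟨g, hg, hgrad, hlt⟩ := hsemi
  exact ⟨g, hg, hgrad, modular_div_le_one_of_luxNorm_lt hp hlt⟩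

lemma enorm_div_coe (t : ℝ) {l : ℝ≥0} (hl : 0 < l) : ‖t / (l : ℝ)‖ₑ = ‖t‖ₑ / l := by
  rw [Real.enorm_eq_ofReal_abs, Real.enorm_eq_ofReal_abs, abs_div, NNReal.abs_eq,
    ENNReal.ofReal_div_of_pos (NNReal.coe_pos.2 hl), ENNReal.ofReal_coe_nnreal]

lemma IsScalarGradient.div {g : X → ℝ≥0∞} (hg : IsScalarGradient μ s u g) {l : ℝ≥0}
    (hl : 0 < l) : IsScalarGradient μ s (fun x => u x / l) (fun x => g x / l) := by
  obtain ⟨N, hN, hg⟩ := hg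
  refine ⟨N, hN, fun x hx y hy => ?_⟩
  rw [← sub_div, ← Real.enorm_eq_ofReal_abs, enorm_div_coe _ hl, Real.enorm_eq_ofReal_abs,
    ← mul_div_assoc, ← mul_div_assoc, ← ENNReal.add_div]
  exact ENNReal.div_le_div_right (hg x hx y hy) _

lemma le_mul_of_forall_lt_coe {a N : ℝ≥0∞} {L : ℝ≥0} (hN : N ≠ ∞)
    (h : ∀ l : ℝ≥0, N < l → a ≤ L * l) : a ≤ L * N := by
  lift N to ℝ≥0 using hN
  have hlim : Filter.Tendsto (fun l : ℝ≥0 => (L : ℝ≥0∞) * l) (nhdsWithin N (Set.Ioi N))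
      (nhds (L * N)) :=
    ((ENNReal.continuous_const_mul ENNReal.coe_ne_top).comp
      ENNReal.continuous_coe).continuousWithinAt
  refine ge_of_tendsto hlim ?_
  filter_upwards [self_mem_nhdsWithin] with l hl using h l (ENNReal.coe_lt_coe.2 hl)

end HajlaszNorm

section LowerRegular

/-- Variable lower Ahlfors regularity: balls of radius `r ≤ δ` have measure at least `b * r ^ Q`,
with the exponent evaluated at the centre. -/
def LowerRegular {X : Type*} [MetricSpace X] [MeasurableSpace X] (μ : Measure X) (Q : X → ℝ)
    (δ b : ℝ) : Prop :=
  ∀ (x : X) (r : ℝ), 0 < r → r ≤ δ → ENNReal.ofReal (b * r ^ Q x) ≤ μ (ball x r)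

/-- The energy `f ^ p + g ^ p` of a function of modulus `f` with gradient `g`. -/
noncomputable def energy {X : Type*} (p : X → ℝ) (f g : X → ℝ≥0∞) (x : X) : ℝ≥0∞ :=
  f x ^ p x + g x ^ p x

variable {X : Type*} [MeasurableSpace X] {μ : Measure X} {p : X → ℝ} {f g : X → ℝ≥0∞}

lemma lintegral_energy_le_two (hp : AEMeasurable p μ) (hf : AEMeasurable f μ)
    (hfm : modular μ p f ≤ 1) (hgm : modular μ p g ≤ 1) : ∫⁻ x, energy p f g x ∂μ ≤ 2 := by
  simp only [energy]
  rw [lintegral_add_left' (hf.pow hp), ← one_add_one_eq_two]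
  exact add_le_add hfm hgm

lemma exists_mem_inter_le_of_lintegral_lt {B D : Set X} {ε : ℝ≥0∞} (hf : AEMeasurable f μ)
    (hD : ∀ᵐ x ∂μ, x ∈ D) (h : ∫⁻ x, f x ∂μ < ε * μ B) : ∃ x ∈ B ∩ D, f x ≤ ε := by
  by_contra! hlt
  have hBsub : μ B ≤ μ {x | ε ≤ f x} := by
    refine measure_mono_ae ?_
    filter_upwards [hD] with x hxD hxB using (hlt x ⟨hxB, hxD⟩).le
  exact h.not_ge ((mul_le_mul_right hBsub ε).trans (mul_meas_ge_le_lintegral₀ hf ε))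

lemma toReal_le_rpow_of_rpow_le {a E : ℝ≥0∞} {t : ℝ} (ht : 0 < t) (h : a ^ t ≤ E) (hE : E ≠ ∞) :
    a.toReal ≤ E.toReal ^ (1 / t) := by
  rw [ENNReal.toReal_rpow, one_div]
  exact ENNReal.toReal_mono (ENNReal.rpow_ne_top_of_nonneg (by positivity) hE)
    ((ENNReal.le_rpow_inv_iff ht).2 h)

lemma abs_sub_le_of_gradient_le {a d₁ d₂ : ℝ} {g₁ g₂ : ℝ≥0∞} (hd₁ : 0 ≤ d₁) (hd₂ : 0 ≤ d₂)
    (hg₁ : g₁ ≠ ∞) (hg₂ : g₂ ≠ ∞)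
    (h : ENNReal.ofReal a ≤ ENNReal.ofReal d₁ * g₁ + ENNReal.ofReal d₂ * g₂) :
    a ≤ d₁ * g₁.toReal + d₂ * g₂.toReal := by
  lift g₁ to ℝ≥0 using hg₁
  lift g₂ to ℝ≥0 using hg₂
  rw [← ENNReal.ofReal_coe_nnreal, ← ENNReal.ofReal_coe_nnreal, ← ENNReal.ofReal_mul hd₁,
    ← ENNReal.ofReal_mul hd₂, ← ENNReal.ofReal_add (by positivity) (by positivity)] at h
  exact (ENNReal.ofReal_le_ofReal_iff (by positivity)).1 h

end LowerRegular

lemma holderNorm_le {X : Type*} [MetricSpace X] {α v : X → ℝ} {A : ℝ} (hv : ∀ x, |v x| ≤ A)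
    (hvα : ∀ x y, |v x - v y| ≤ A * dist x y ^ α x) : holderNorm α v ≤ 2 * ENNReal.ofReal A := by
  rw [two_mul]
  refine add_le_add (iSup_le fun x => ?_) (iSup_le fun x => iSup₂_le fun y hxy => ?_)
  · rw [Real.enorm_eq_ofReal_abs]
    exact ENNReal.ofReal_le_ofReal (hv x)
  · refine ENNReal.ofReal_le_ofReal ?_
    rw [div_le_iff₀ (Real.rpow_pos_of_pos (dist_pos.2 hxy) _)]
    exact hvα x y

section Embeddings

variable {X : Type*} [MetricSpace X] [MeasurableSpace X] {μ : Measure X} {Q p s u : X → ℝ}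
  {δ b c : ℝ}

lemma LowerRegular.isOpenPosMeasure (hμ : LowerRegular μ Q δ b) (hδ : 0 < δ) (hb : 0 < b) :
    μ.IsOpenPosMeasure := by
  refine ⟨fun U hU ⟨x, hx⟩ hzero => ?_⟩
  obtain ⟨r, hr, hsub⟩ := Metric.isOpen_iff.1 hU x hx
  have hpos : 0 < μ (ball x (min r δ)) :=
    (ENNReal.ofReal_pos.2 (by positivity)).trans_le (hμ x _ (lt_min hr hδ) (min_le_right _ _))
  exact hpos.ne' (measure_mono_null ((ball_subset_ball (min_le_left _ _)).trans hsub) hzero)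

lemma LowerRegular.exists_energy_le (hμ : LowerRegular μ Q δ b) (hb : 0 < b) {E : X → ℝ≥0∞}
    (hE : AEMeasurable E μ) (hEint : ∫⁻ x, E x ∂μ ≤ 2) {D : Set X} (hD : ∀ᵐ x ∂μ, x ∈ D) (x : X)
    {ρ : ℝ} (hρ : 0 < ρ) (hρδ : ρ ≤ δ) :
    ∃ y ∈ D, dist x y ≤ ρ ∧ (E y).toReal ≤ 3 / b * ρ ^ (-Q x) := by
  have hball : ∫⁻ x, E x ∂μ < ENNReal.ofReal (3 / b * ρ ^ (-Q x)) * μ (ball x ρ) :=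
    calc ∫⁻ x, E x ∂μ ≤ 2 := hEint
      _ < ENNReal.ofReal 3 := by norm_num
      _ = ENNReal.ofReal (3 / b * ρ ^ (-Q x)) * ENNReal.ofReal (b * ρ ^ Q x) := by
        rw [← ENNReal.ofReal_mul (by positivity), Real.rpow_neg hρ.le]
        congr 1
        have := (Real.rpow_pos_of_pos hρ (Q x)).ne'
        field_simp
      _ ≤ ENNReal.ofReal (3 / b * ρ ^ (-Q x)) * μ (ball x ρ) := by gcongr; exact hμ x ρ hρ hρδ
  obtain ⟨y, ⟨hyB, hyD⟩, hEy⟩ := exists_mem_inter_le_of_lintegral_lt hE hD hball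
  exact ⟨y, hyD, (mem_ball'.1 hyB).le, ENNReal.toReal_le_of_le_ofReal (by positivity) hEy⟩

lemma LowerRegular.exists_isEnergyDensity (hμ : LowerRegular μ Q δ b) (hb : 0 < b)
    (hp : ∀ x, 0 < p x) (hpm : AEMeasurable p μ) (hu : AEMeasurable u μ)
    (hum : modular μ p (fun x => ‖u x‖ₑ) ≤ 1) {g : X → ℝ≥0∞} (hg : AEMeasurable g μ)
    (hgrad : IsScalarGradient μ s u g) (hgm : modular μ p g ≤ 1) :
    ∃ (D : Set X) (E : X → ℝ≥0∞), (∀ᵐ x ∂μ, x ∈ D) ∧ (∀ x ∈ D, E x ≠ ∞) ∧ ∫⁻ x, E x ∂μ ≤ 2 ∧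
      IsEnergyDensity D Q p s (3 / b) δ u (fun x => (E x).toReal) := by
  obtain ⟨N, hN, hgrad⟩ := hgrad
  set E := energy p (fun x => ‖u x‖ₑ) g
  have hE : AEMeasurable E μ := (hu.enorm.pow hpm).add (hg.pow hpm)
  have hEint : ∫⁻ x, E x ∂μ ≤ 2 := lintegral_energy_le_two hpm hu.enorm hum hgm
  have hD : ∀ᵐ x ∂μ, x ∈ {x | x ∉ N ∧ E x < ∞} :=
    (measure_eq_zero_iff_ae_notMem.1 hN).and
      (ae_lt_top' hE (hEint.trans_lt ENNReal.ofNat_lt_top).ne)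
  have hu_le (x : X) (hx : E x < ∞) : |u x| ≤ (E x).toReal ^ (1 / p x) := by
    have hpow : ‖u x‖ₑ ^ p x ≤ E x := le_self_add
    simpa only [toReal_enorm, Real.norm_eq_abs] using
      toReal_le_rpow_of_rpow_le (hp x) hpow hx.ne
  have hg_le (x : X) (hx : E x < ∞) : (g x).toReal ≤ (E x).toReal ^ (1 / p x) :=
    toReal_le_rpow_of_rpow_le (hp x) (le_add_self : g x ^ p x ≤ E x) hx.ne
  have hg_top (x : X) (hx : E x < ∞) : g x ≠ ∞ := fun htop =>
    (le_add_self.trans_lt hx : g x ^ p x < ∞).ne (by rw [htop, ENNReal.top_rpow_of_pos (hp x)])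
  refine ⟨_, E, hD, fun x hx => hx.2.ne, hEint, fun x => ENNReal.toReal_nonneg,
    fun x hx => hu_le x hx.2, fun x hx y hy => ?_,
    fun x ρ hρ hρδ => hμ.exists_energy_le hb hE hEint hD x hρ hρδ⟩
  calc |u x - u y| ≤ dist x y ^ s x * (g x).toReal + dist x y ^ s y * (g y).toReal :=
        abs_sub_le_of_gradient_le (by positivity) (by positivity) (hg_top x hx.2)
          (hg_top y hy.2) (hgrad x hx.1 y hy.1)
    _ ≤ _ := by
        gcongr
        exacts [hg_le x hx.2, hg_le y hy.2]

lemma LowerRegular.exists_isEnergyDensity_of_hajlaszNorm_lt (hμ : LowerRegular μ Q δ b)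
    (hb : 0 < b) (hp : ∀ x, 0 < p x) (hpm : AEMeasurable p μ) (hu : AEMeasurable u μ) {l : ℝ≥0}
    (hul : hajlaszNorm μ s p u < l) :
    ∃ (D : Set X) (E : X → ℝ≥0∞), (∀ᵐ x ∂μ, x ∈ D) ∧ (∀ x ∈ D, E x ≠ ∞) ∧ ∫⁻ x, E x ∂μ ≤ 2 ∧
      IsEnergyDensity D Q p s (max (3 / b) 1) (min δ 1) (fun x => u x / l)
        (fun x => (E x).toReal) := by
  have hl : 0 < l := ENNReal.coe_pos.1 (zero_le.trans_lt hul)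
  obtain ⟨hum, g, hg, hgrad, hgm⟩ := exists_gradient_of_hajlaszNorm_lt (fun x => (hp x).le) hul
  simp only [← enorm_div_coe _ hl] at hum
  obtain ⟨D, E, hD, hE, hEint, hden⟩ := hμ.exists_isEnergyDensity hb hp hpm (hu.div_const _) hum
    (hg.div_const _) (hgrad.div hl) hgm
  exact ⟨D, E, hD, hE, hEint, hden.mono (le_max_left _ _) (min_le_left _ _)⟩

lemma LowerRegular.exists_modular_div_le (hμ : LowerRegular μ Q δ b) (hδ : 0 < δ) (hb : 0 < b)
    (hA : IsAdmissibleTriple Q p s) (hpm : AEMeasurable p μ) {τ : X → ℝ}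
    (hτ : BoundedExponent μ τ) (hpτ : ∀ᵐ x ∂μ, p x ≤ τ x)
    (hcrit : ∀ᵐ x ∂μ, -(Q x / τ x) ≤ s x - Q x / p x) :
    ∃ M : ℝ≥0, ∀ u : X → ℝ, AEMeasurable u μ → ∀ l : ℝ≥0, hajlaszNorm μ s p u < l →
      modular μ τ (fun x => ‖u x‖ₑ / l) ≤ M := by
  obtain ⟨-, hτ0, -, T, hT⟩ := hτ
  obtain ⟨C, hC, hpt⟩ := hA.exists_abs_rpow_le (le_max_right (3 / b) 1) (lt_min hδ one_pos)
    (min_le_right δ 1) (lt_max_of_lt_right one_pos : 0 < max T 1)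
  refine ⟨C.toNNReal * 2, fun u hu l hul => ?_⟩
  have hl : 0 < l := ENNReal.coe_pos.1 (zero_le.trans_lt hul)
  obtain ⟨D, E, hD, hE, hEint, hden⟩ :=
    hμ.exists_isEnergyDensity_of_hajlaszNorm_lt hb hA.exponent.pos hpm hu hul
  simp only [← enorm_div_coe _ hl]
  calc modular μ τ (fun x => ‖u x / l‖ₑ)
      ≤ ∫⁻ x, C.toNNReal * E x ∂μ := by
        refine lintegral_mono_ae ?_
        filter_upwards [hD, hpτ, hcrit, hT] with x hx hpx hcx hTx
        rw [Real.enorm_eq_ofReal_abs, ENNReal.ofReal_rpow_of_nonneg (abs_nonneg _) (hτ0 x).le]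
        calc ENNReal.ofReal (|u x / l| ^ τ x)
            ≤ ENNReal.ofReal (C * (E x).toReal) := ENNReal.ofReal_le_ofReal
              (hpt hden x (τ x) hx hpx (hTx.trans (le_max_left _ _)) hcx)
          _ = C.toNNReal * E x := by
              rw [ENNReal.ofReal_mul hC.le, ENNReal.ofReal_toReal (hE x hx), ENNReal.ofReal]
    _ = C.toNNReal * ∫⁻ x, E x ∂μ := lintegral_const_mul' _ _ ENNReal.coe_ne_top
    _ ≤ (C.toNNReal * 2 : ℝ≥0) := by
        rw [ENNReal.coe_mul, ENNReal.coe_ofNat]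
        gcongr

theorem LowerRegular.embedsInVarL (hμ : LowerRegular μ Q δ b) (hδ : 0 < δ) (hb : 0 < b)
    (hA : IsAdmissibleTriple Q p s) (hpm : AEMeasurable p μ) {τ : X → ℝ}
    (hτ : BoundedExponent μ τ) (hpτ : ∀ᵐ x ∂μ, p x ≤ τ x)
    (hcrit : ∀ᵐ x ∂μ, -(Q x / τ x) ≤ s x - Q x / p x) : EmbedsInVarL μ s p τ := by
  obtain ⟨M, hM⟩ := hμ.exists_modular_div_le hδ hb hA hpm hτ hpτ hcrit
  obtain ⟨-, hτ0, ⟨t, ht, htτ⟩, T, hT⟩ := hτ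
  have hτ_nonneg (x : X) : 0 ≤ τ x := (hτ0 x).le
  obtain ⟨L, -, hL⟩ := exists_luxNorm_le_mul hτ_nonneg ht htτ M
  obtain ⟨a, ha, hap⟩ := hA.exponent.exists_pos_le
  have hl {u : X → ℝ} {l : ℝ≥0} (hul : hajlaszNorm μ s p u < l) : 0 < l :=
    ENNReal.coe_pos.1 (zero_le.trans_lt hul)
  refine ⟨L, fun u hu => ?_⟩
  have hfin : hajlaszNorm μ s p u < ∞ :=
    hu.hajlaszNorm_lt_top (fun x => (hA.exponent.pos x).le) ha (.of_forall hap)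
  obtain ⟨l₀, hul₀, -⟩ := ENNReal.lt_iff_exists_nnreal_btwn.1 hfin
  have hmem : modular μ τ (fun x => ‖u x‖ₑ) < ∞ := modular_lt_top_of_div hτ_nonneg hT (hl hul₀)
    ((hM u hu.1.1 l₀ hul₀).trans_lt ENNReal.coe_lt_top)
  exact ⟨⟨hu.1.1, hmem⟩, le_mul_of_forall_lt_coe hfin.ne fun l hul =>
    hL _ l (hl hul) (hM u hu.1.1 l hul)⟩

lemma LowerRegular.exists_continuous_holderNorm_le (hμ : LowerRegular μ Q δ b) (hδ : 0 < δ)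
    (hb : 0 < b) (hA : IsAdmissibleTriple Q p s) (hQL : LogHolder Q) (hpm : AEMeasurable p μ)
    (hc : 0 < c) (hα : ∀ x, c ≤ s x - Q x / p x) :
    ∃ K : ℝ≥0, ∀ u : X → ℝ, AEMeasurable u μ → ∀ l : ℝ≥0, hajlaszNorm μ s p u < l →
      ∃ v : X → ℝ, Continuous v ∧ u =ᵐ[μ] v ∧
        holderNorm (fun x => s x - Q x / p x) v ≤ K * l := by
  have hΛ : 1 ≤ max (3 / b) 1 := le_max_right _ _
  have hρ₀ : 0 < min δ 1 := lt_min hδ one_pos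
  have hρ₁ : min δ 1 ≤ 1 := min_le_right _ _
  obtain ⟨A, hA0, hsup⟩ := hA.exists_abs_le hΛ hρ₀ hρ₁ hc hα
  obtain ⟨B, hB0, hhol⟩ := hA.exists_abs_sub_le_mul_dist_rpow hQL hΛ hρ₀ hρ₁ hc hα
  refine ⟨2 * (max A B).toNNReal, fun u hu l hul => ?_⟩
  have hl : (0 : ℝ) < l := NNReal.coe_pos.2 (ENNReal.coe_pos.1 (zero_le.trans_lt hul))
  obtain ⟨D, E, hD, -, -, hden⟩ :=
    hμ.exists_isEnergyDensity_of_hajlaszNorm_lt hb hA.exponent.pos hpm hu hul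
  have hu_le : ∀ x ∈ D, |u x| ≤ A * l := fun x hx => by
    simpa only [abs_div, NNReal.abs_eq, div_le_iff₀ hl] using hsup hden x hx
  have hu_sub_le : ∀ x ∈ D, ∀ y ∈ D, |u x - u y| ≤ B * l * dist x y ^ (s x - Q x / p x) :=
    fun x hx y hy => by
      have hxy := hhol hden x hx y hy
      rwa [← sub_div, abs_div, NNReal.abs_eq, div_le_iff₀ hl, mul_right_comm] at hxy
  obtain ⟨v, hv, hvu, hvA, hvB⟩ := exists_continuous_extension_of_dense (hden.dense hρ₀)
    (hA.logHolder_sub_div hQL).continuous hc hα (mul_pos hB0 hl) hu_le hu_sub_le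
  refine ⟨v, hv, hD.mono fun x hx => (hvu x hx).symm, ?_⟩
  calc holderNorm (fun x => s x - Q x / p x) v ≤ 2 * ENNReal.ofReal (max A B * l) := by
        refine holderNorm_le (fun x => (hvA x).trans ?_) fun x y => (hvB x y).trans ?_
        · gcongr
          exact le_max_left _ _
        · gcongr
          exact le_max_right _ _
    _ = (2 * (max A B).toNNReal : ℝ≥0) * l := by
        rw [ENNReal.ofReal_mul (by positivity), ENNReal.ofReal_coe_nnreal, ENNReal.coe_mul,
          ENNReal.coe_ofNat, mul_assoc, ENNReal.ofReal]

theorem LowerRegular.embedsInHolder (hμ : LowerRegular μ Q δ b) (hδ : 0 < δ) (hb : 0 < b)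
    (hA : IsAdmissibleTriple Q p s) (hQL : LogHolder Q) (hpm : AEMeasurable p μ) (hc : 0 < c)
    (hα : ∀ x, c ≤ s x - Q x / p x) : EmbedsInHolder μ s p (fun x => s x - Q x / p x) := by
  have := hμ.isOpenPosMeasure hδ hb
  obtain ⟨K, hK⟩ := hμ.exists_continuous_holderNorm_le hδ hb hA hQL hpm hc hα
  obtain ⟨a, ha, hap⟩ := hA.exponent.exists_pos_le
  refine ⟨K, fun u hu => ?_⟩
  have hfin : hajlaszNorm μ s p u < ∞ :=
    hu.hajlaszNorm_lt_top (fun x => (hA.exponent.pos x).le) ha (.of_forall hap)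
  obtain ⟨l₀, hul₀, -⟩ := ENNReal.lt_iff_exists_nnreal_btwn.1 hfin
  obtain ⟨v, hv, huv, hvK⟩ := hK u hu.1.1 l₀ hul₀
  have hvfin : holderNorm (fun x => s x - Q x / p x) v < ∞ :=
    hvK.trans_lt (ENNReal.mul_lt_top ENNReal.coe_lt_top ENNReal.coe_lt_top)
  refine ⟨v, huv, ⟨hv, le_self_add.trans_lt hvfin, le_add_self.trans_lt hvfin⟩,
    le_mul_of_forall_lt_coe hfin.ne fun l hul => ?_⟩
  obtain ⟨w, hw, huw, hwK⟩ := hK u hu.1.1 l hul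
  rwa [(hv.ae_eq_iff_eq μ hw).1 (huv.symm.trans huw)]

end Embeddings

section Exponents

variable {X : Type*} [MetricSpace X] [MeasurableSpace X] {μ : Measure X} {Q p s : X → ℝ} {c : ℝ}

lemma LogExponent.continuous (hp : LogExponent μ p) : Continuous p := by
  have hinv := hp.2.continuous.inv₀ fun x => (one_div_pos.2 (hp.1.2.1 x)).ne'
  simpa only [one_div, Pi.inv_def, inv_inv] using hinv

lemma LogExponent.measurable (hp : LogExponent μ p) : Measurable p := hp.1.1

lemma forall_of_ae_of_isClosed {Y : Type*} [TopologicalSpace Y] [MeasurableSpace Y]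
    {ν : Measure Y} [ν.IsOpenPosMeasure] {P : Y → Prop} (hP : IsClosed {y | P y})
    (h : ∀ᵐ y ∂ν, P y) (y : Y) : P y :=
  hP.closure_subset (Measure.dense_of_ae h y)

lemma LogExponent.isUniformExponent [μ.IsOpenPosMeasure] (hp : LogExponent μ p) :
    IsUniformExponent p := by
  have hcont := hp.continuous
  obtain ⟨⟨-, -, ⟨c, hc, hcp⟩, C, hCp⟩, -⟩ := hp
  exact ⟨c, hc, max C 1, by positivity, fun x =>
    ⟨forall_of_ae_of_isClosed (isClosed_le continuous_const hcont) hcp x,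
      (forall_of_ae_of_isClosed (isClosed_le hcont continuous_const) hCp x).trans
        (le_max_left _ _)⟩⟩

lemma LogExponent.logHolder [μ.IsOpenPosMeasure] (hp : LogExponent μ p) : LogHolder p :=
  hp.isUniformExponent.logHolder_of_one_div hp.2

lemma LogExponent.isAdmissibleTriple [μ.IsOpenPosMeasure] (hQ : LogExponent μ Q)
    (hp : LogExponent μ p) (hs : LogExponent μ s) : IsAdmissibleTriple Q p s where
  dim := hQ.isUniformExponent
  exponent := hp.isUniformExponent
  smoothness := hs.isUniformExponent
  logHolder_exponent := hp.2
  logHolder_smoothness := hs.logHolder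

lemma EssGT.exists_pos_le_sub [μ.IsOpenPosMeasure] (h : EssGT μ Q p) (hQ : Continuous Q)
    (hp : Continuous p) : ∃ c > 0, ∀ x, c ≤ Q x - p x := by
  obtain ⟨c, hc, hcae⟩ := h
  exact ⟨c, hc, forall_of_ae_of_isClosed (isClosed_le continuous_const (hQ.sub hp)) hcae⟩

lemma EssGT.ae_le {X : Type*} [MeasurableSpace X] {μ : Measure X} {q p : X → ℝ}
    (h : EssGT μ q p) : ∀ᵐ x ∂μ, p x ≤ q x := by
  obtain ⟨c, hc, hcae⟩ := h
  exact hcae.mono fun x hx => sub_nonneg.1 (hc.le.trans hx)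

lemma le_mul_div_sub {Q p t : ℝ} (hp : 0 ≤ p) (ht : 0 ≤ t) (htQ : t < Q) : p ≤ Q * p / (Q - t) := by
  rw [le_div_iff₀ (sub_pos.2 htQ), mul_comm Q p]
  gcongr
  exact sub_le_self Q ht

lemma IsAdmissibleTriple.boundedExponent_mul_div_sub (hA : IsAdmissibleTriple Q p s)
    (hQm : Measurable Q) (hpm : Measurable p) (hsm : Measurable s) (hc : 0 < c)
    (hgap : ∀ x, c ≤ Q x - s x * p x) :
    BoundedExponent μ (fun x => Q x * p x / (Q x - s x * p x)) := by
  have hgap_pos (x : X) : 0 < Q x - s x * p x := hc.trans_le (hgap x)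
  obtain ⟨K, hK, hQK⟩ := hA.dim.exists_pos_ge
  obtain ⟨a, ha, hap⟩ := hA.exponent.exists_pos_le
  obtain ⟨P, hP, hpP⟩ := hA.exponent.exists_pos_ge
  refine ⟨(hQm.mul hpm).div (hQm.sub (hsm.mul hpm)),
    fun x => div_pos (mul_pos (hA.dim.pos x) (hA.exponent.pos x)) (hgap_pos x),
    ⟨a, ha, .of_forall fun x => (hap x).trans ?_⟩, K * P / c, .of_forall fun x => ?_⟩
  · exact le_mul_div_sub (hA.exponent.pos x).le
      (mul_pos (hA.smoothness.pos x) (hA.exponent.pos x)).le (sub_pos.1 (hgap_pos x))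
  · exact div_le_div₀ (by positivity)
      (mul_le_mul (hQK x) (hpP x) (hA.exponent.pos x).le hK.le) hc (hgap x)

end Exponents

section Regimes

variable {X : Type*} [MetricSpace X] [MeasurableSpace X] {μ : Measure X} {Q p s : X → ℝ}
  {δ b : ℝ}

theorem LowerRegular.embedsInVarL_of_subcritical (hμ : LowerRegular μ Q δ b) (hδ : 0 < δ)
    (hb : 0 < b) (hQ : LogExponent μ Q) (hp : LogExponent μ p) (hs : LogExponent μ s)
    (hsp : EssGT μ Q (fun x => s x * p x)) :
    BoundedExponent μ (fun x => Q x * p x / (Q x - s x * p x)) ∧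
      EmbedsInVarL μ s p (fun x => Q x * p x / (Q x - s x * p x)) := by
  have := hμ.isOpenPosMeasure hδ hb
  have hA := hQ.isAdmissibleTriple hp hs
  obtain ⟨c, hc, hgap⟩ := hsp.exists_pos_le_sub hQ.continuous (hs.continuous.mul hp.continuous)
  have hγ := hA.boundedExponent_mul_div_sub (μ := μ) hQ.measurable hp.measurable hs.measurable
    hc hgap
  refine ⟨hγ, hμ.embedsInVarL hδ hb hA hp.measurable.aemeasurable hγ (.of_forall fun x => ?_)
    (.of_forall fun x => ?_)⟩
  · exact le_mul_div_sub (hA.exponent.pos x).le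
      (mul_pos (hA.smoothness.pos x) (hA.exponent.pos x)).le (sub_pos.1 (hc.trans_le (hgap x)))
  · have hQx := (hA.dim.pos x).ne'
    have hpx := (hA.exponent.pos x).ne'
    refine le_of_eq ?_
    field_simp
    ring

theorem LowerRegular.embedsInVarL_of_critical_le (hμ : LowerRegular μ Q δ b) (hδ : 0 < δ)
    (hb : 0 < b) (hQ : LogExponent μ Q) (hp : LogExponent μ p) (hs : LogExponent μ s)
    (hsp : ∀ᵐ x ∂μ, Q x ≤ s x * p x) {β : X → ℝ} (hβ : BoundedExponent μ β)
    (hpβ : ∀ᵐ x ∂μ, p x ≤ β x) : EmbedsInVarL μ s p β := by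
  have := hμ.isOpenPosMeasure hδ hb
  have hA := hQ.isAdmissibleTriple hp hs
  refine hμ.embedsInVarL hδ hb hA hp.measurable.aemeasurable hβ hpβ ?_
  filter_upwards [hsp] with x hx
  calc -(Q x / β x) ≤ 0 := neg_nonpos.2 (div_pos (hA.dim.pos x) (hβ.2.1 x)).le
    _ ≤ s x - Q x / p x := sub_nonneg.2 ((div_le_iff₀ (hA.exponent.pos x)).2 hx)

theorem LowerRegular.embedsInHolder_of_supercritical (hμ : LowerRegular μ Q δ b) (hδ : 0 < δ)
    (hb : 0 < b) (hQ : LogExponent μ Q) (hp : LogExponent μ p) (hs : LogExponent μ s)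
    (hsp : EssGT μ (fun x => s x * p x) Q) :
    (∃ A : ℝ, ∀ x, 0 ≤ s x - Q x / p x ∧ s x - Q x / p x ≤ A) ∧
      EmbedsInHolder μ s p (fun x => s x - Q x / p x) := by
  have := hμ.isOpenPosMeasure hδ hb
  have hA := hQ.isAdmissibleTriple hp hs
  obtain ⟨c, hc, hgap⟩ := hsp.exists_pos_le_sub (hs.continuous.mul hp.continuous) hQ.continuous
  obtain ⟨a, ha, hα⟩ := hA.exists_pos_le_sub_div hc hgap
  obtain ⟨S, -, hsS⟩ := hA.smoothness.exists_pos_ge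
  exact ⟨⟨S, fun x => ⟨ha.le.trans (hα x), (hA.sub_div_le x).trans (hsS x)⟩⟩,
    hμ.embedsInHolder hδ hb hA hQ.logHolder hp.measurable.aemeasurable ha hα⟩

end Regimes

end VarHajlasz

theorem mainTheorem2_general {X : Type*} [MetricSpace X] [MeasurableSpace X]
    {μ : Measure X} {Q p s : X → ℝ} {δ b : ℝ} (hδ : 0 < δ) (hb : 0 < b)
    (hlow : VarHajlasz.LowerRegular μ Q δ b) (hQ : VarHajlasz.LogExponent μ Q)
    (hp : VarHajlasz.LogExponent μ p) (hs : VarHajlasz.LogExponent μ s) :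
    (VarHajlasz.EssGT μ Q (fun x => s x * p x) →
      VarHajlasz.BoundedExponent μ (fun x => Q x * p x / (Q x - s x * p x)) ∧
      VarHajlasz.EmbedsInVarL μ s p (fun x => Q x * p x / (Q x - s x * p x))) ∧
    ((∀ᵐ x ∂μ, Q x ≤ s x * p x) → ∀ β : X → ℝ, VarHajlasz.BoundedExponent μ β →
      (∀ᵐ x ∂μ, p x ≤ β x) → VarHajlasz.EmbedsInVarL μ s p β) ∧
    (VarHajlasz.EssGT μ (fun x => s x * p x) Q →
      (∃ A : ℝ, ∀ x, 0 ≤ s x - Q x / p x ∧ s x - Q x / p x ≤ A) ∧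
      VarHajlasz.EmbedsInHolder μ s p (fun x => s x - Q x / p x)) :=
  ⟨hlow.embedsInVarL_of_subcritical hδ hb hQ hp hs,
    fun hsp _ => hlow.embedsInVarL_of_critical_le hδ hb hQ hp hs hsp,
    hlow.embedsInHolder_of_supercritical hδ hb hQ hp hs⟩

theorem mainTheorem2 {X : Type*} [MetricSpace X] [MeasurableSpace X] [BorelSpace X]
    (μ : Measure X) (hμ : VarHajlasz.IsMetricMeasure μ)
    (Q : X → ℝ) (hQ : VarHajlasz.LogExponent μ Q)
    (δ b : ℝ) (hδ : 0 < δ) (hb : 0 < b) (hb1 : b ≤ 1)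
    (hlow : ∀ (x : X) (r : ℝ), 0 < r → r ≤ δ → ENNReal.ofReal (b * r ^ Q x) ≤ μ (ball x r)) :
    (VarHajlasz.GeometricallyDoubling X → (⨆ x : X, μ (ball x δ)) < ∞ →
      ∀ p s : X → ℝ, VarHajlasz.LogExponent μ p → VarHajlasz.LogExponent μ s →
        VarHajlasz.EssGT μ Q (fun x => s x * p x) →
        VarHajlasz.BoundedExponent μ (fun x => Q x * p x / (Q x - s x * p x)) ∧
        VarHajlasz.EmbedsInVarL μ s p (fun x => Q x * p x / (Q x - s x * p x))) ∧
    (VarHajlasz.GeometricallyDoubling X → (⨆ x : X, μ (ball x δ)) < ∞ →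
      ∀ p s : X → ℝ, VarHajlasz.LogExponent μ p → VarHajlasz.LogExponent μ s →
        (∀ x, s x * p x = Q x) →
        ∀ β : X → ℝ, VarHajlasz.BoundedExponent μ β → VarHajlasz.EssGT μ β p →
          VarHajlasz.EmbedsInVarL μ s p β) ∧
    (∀ p s : X → ℝ, VarHajlasz.LogExponent μ p → VarHajlasz.LogExponent μ s →
        VarHajlasz.EssGT μ (fun x => s x * p x) Q →
        (∃ A : ℝ, ∀ x, 0 ≤ s x - Q x / p x ∧ s x - Q x / p x ≤ A) ∧
        VarHajlasz.EmbedsInHolder μ s p (fun x => s x - Q x / p x)) :=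
  ⟨fun _ _ _ _ hp hs => (mainTheorem2_general hδ hb hlow hQ hp hs).1,
    fun _ _ _ _ hp hs hsp β hβ hpβ => (mainTheorem2_general hδ hb hlow hQ hp hs).2.1
      (.of_forall fun x => (hsp x).ge) β hβ hpβ.ae_le,
    fun _ _ hp hs => (mainTheorem2_general hδ hb hlow hQ hp hs).2.2⟩
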